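/- Let $G$ be an $n$-vertex $r$-regular finite simple graph that is neither bipartite nor an $n$-cycle, and let $\mathcal N_i$ be the set of neighbours of the vertex $i$. The anti-voter chain on $G$ is the Markov chain $J^{(t)}=(J_i^{(t)})_i\in\{0,1\}^n$, $t\in\mathbb N$, with this transition: choose a vertex $i$ uniformly at random, then a vertex $j\in\mathcal N_i$ uniformly at random, put $J_i^{(t+1)}=1-J_j^{(t)}$, and leave all other opinions unchanged. Let the chain be in equilibrium (the law of $J^{(t)}$ does not depend on $t$). Write $J_i=J_i^{(0)}$, $W=\sum_iJ_i$, $W'=\sum_iJ_i^{(1)}$, $\mu=\mathbb EW$, $\sigma^2=\operatorname{Var}W$ with $\sigma\ge 0$, $S=\mathbb P[W'=W+1\mid W]$, $q_{\max}=\max_{k\in\mathbb Z}\mathbb P[W=k]$, $\lambda=2/n$ and $$Q=\sum_{i}\sum_{j\in\mathcal N_i}(2J_i-1)(2J_j-1).$$ Let $\mathrm{TP}(\mu,\sigma^2)$ be the law of an integer-valued $Y$ such that $Y-\mu+\sigma^2+\gamma$ is Poisson distributed with mean $\sigma^2+\gamma$, where $\gamma=(\mu-\sigma^2)-\lfloor\mu-\sigma^2\rfloor$.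 For probability measures $P_1,P_2$ on $\mathbb Z$ put $d_{\mathrm{TV}}(P_1,P_2)=\sup_{A\subset\mathbb Z}|P_1(A)-P_2(A)|$ and $d_{\mathrm{loc}}(P_1,P_2)=\sup_{k\in\mathbb Z}|P_1(\{k\})-P_2(\{k\})|$. Then $\sigma>0$, $0<\lambda<1$, the pair $(W,W')$ is exchangeable, almost surely $\mathbb E[W'-\mu\mid W]=(1-\lambda)(W-\mu)$ and $W'-W\in\{-1,0,1\}$, and $$d_{\mathrm{TV}}(\mathcal L(W),\mathrm{TP}(\mu,\sigma^2))\le\frac{\sqrt{\operatorname{Var}S}}{\lambda\sigma^2}+\frac{2}{\sigma^2},\qquad d_{\mathrm{loc}}(\mathcal L(W),\mathrm{TP}(\mu,\sigma^2))\le\frac{2\sqrt{q_{\max}\operatorname{Var}S}}{\lambda\sigma^2}+\frac{2}{\sigma^2}.$$ Moreover $$\operatorname{Var}S\le\frac{16r^2\sigma^2+\operatorname{Var}Q}{16r^2n^2}.$$ Consequently there is an absolute constant $C$, independent of $n$, $r$ and $G$, such that $$d_{\mathrm{TV}}(\mathcal L(W),\mathrm{TP}(\mu,\sigma^2))\le C\left(\frac{\sqrt{\operatorname{Var}Q}}{r\sigma^2}+\frac1\sigma\right),\qquad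 d_{\mathrm{loc}}(\mathcal L(W),\mathrm{TP}(\mu,\sigma^2))\le C\left(\frac{(\operatorname{Var}Q)^{3/4}}{r^{3/2}\sigma^3}+\frac1{\sigma^{3/2}}\right).$$ -/

import Mathlib

open MeasureTheory ProbabilityTheory

noncomputable section

/-- One-step transition probability of the anti-voter chain from `x` to `y`: choose a vertex `i`
uniformly at random, then a neighbour `j` of `i` uniformly at random, and replace the opinion of `i`
by the opposite of the opinion of `j`.  Opinion `1` is `true`, opinion `0` is `false`. -/
def antiVoterTransition {V : Type*} [Fintype V] [DecidableEq V] (G : SimpleGraph V)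
    [DecidableRel G.Adj] (x y : V → Bool) : ℝ :=
  (1 / (Fintype.card V : ℝ)) * ∑ i : V, (1 / (G.degree i : ℝ)) *
    ∑ j ∈ G.neighborFinset i, if Function.update x i (!x j) = y then (1 : ℝ) else 0

/-- `J` is the anti-voter chain on `G`, in equilibrium, on the probability space `(Ω, P)`: it is a
time-homogeneous Markov chain with the anti-voter transition probabilities, and the law of its
state does not change with time. -/
structure IsEquilibriumAntiVoter {V : Type*} [Fintype V] [DecidableEq V] (G : SimpleGraph V)
    [DecidableRel G.Adj] {Ω : Type*} [MeasurableSpace Ω] (P : Measure Ω)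
    (J : ℕ → Ω → V → Bool) : Prop where
  measurable : ∀ t, Measurable (J t)
  markov : ∀ (t : ℕ) (x : ℕ → V → Bool),
    P.real {ω | ∀ s ≤ t + 1, J s ω = x s} =
      P.real {ω | ∀ s ≤ t, J s ω = x s} * antiVoterTransition G (x t) (x (t + 1))
  stationary : ∀ t, P.map (J t) = P.map (J 0)

/-- The number of vertices with opinion `1`. -/
def oneCount {V : Type*} [Fintype V] (x : V → Bool) : ℤ :=
  ∑ i : V, ((x i).toNat : ℤ)

/-- `∑ i, ∑ j ∈ N_i, (2 x_i - 1) (2 x_j - 1)`. -/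
def neighbourProductSum {V : Type*} [Fintype V] (G : SimpleGraph V) [DecidableRel G.Adj]
    (x : V → Bool) : ℝ :=
  ∑ i : V, ∑ j ∈ G.neighborFinset i,
    (2 * ((x i).toNat : ℝ) - 1) * (2 * ((x j).toNat : ℝ) - 1)

/-- The translated Poisson distribution `TP(μ, v)`, for `0 ≤ v`: the law of `Y` such that
`Y - μ + v + γ = Y - ⌊μ - v⌋` has the Poisson distribution with mean `v + γ`,
where `γ` is the fractional part of `μ - v`. -/
def translatedPoisson (μ v : ℝ) : Measure ℤ :=
  (poissonMeasure (v + Int.fract (μ - v)).toNNReal).map (fun k : ℕ => (k : ℤ) + ⌊μ - v⌋)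

/-- Total variation distance of probability measures on `ℤ`. -/
def tvDistInt (P Q : Measure ℤ) : ℝ :=
  ⨆ A : Set ℤ, |P.real A - Q.real A|

/-- Local limit metric for probability measures on `ℤ`. -/
def locDistInt (P Q : Measure ℤ) : ℝ :=
  ⨆ k : ℤ, |P.real {k} - Q.real {k}|

/-- The largest point probability of a probability measure on `ℤ`. -/
def maxPointProb (P : Measure ℤ) : ℝ :=
  ⨆ k : ℤ, P.real {k}

end

/-!
By Stein's method the distance from the law of `W` to `TP(μ, σ²)` is the expectation of a Stein
operator. For an exchangeable pair `(W, W')` with unit steps and linear regression,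
`λ Cov(W, g(W)) = E[S (g(W + 1) - g(W))]`, so that, up to terms of order `1 / σ²`, only the
covariance of `S` with a bounded function of `W` remains, and Cauchy-Schwarz applies.
Exchangeability itself is automatic for a stationary pair with unit steps: up- and down-crossings
of each level balance.

For the anti-voter chain `P[W' = W + 1 | J] = 3/4 + Q / (4 n r) - W / n`, and `W` and `Q` are
uncorrelated. Indeed, in equilibrium neighbours outside the components with odd cycles always hold
opposite opinions, hence those components contribute nothing to the centred `W`. Flipping all
opinions on the remaining components preserves the equilibrium law and `Q`, and negates `W - μ`.
-/

noncomputable section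

open Filter Set SimpleGraph
open scoped ENNReal NNReal Matrix fwdDiff

section PoissonStein

theorem succ_mul_poissonMeasure_real_singleton_succ (Λ : ℝ≥0) (k : ℕ) :
    ((k : ℝ) + 1) * (poissonMeasure Λ).real {k + 1} = Λ * (poissonMeasure Λ).real {k} := by
  simp only [poissonMeasure_real_singleton, Nat.factorial_succ, Nat.cast_mul, Nat.cast_succ]
  field_simp
  ring

theorem measureReal_inter_Iio_succ (ν : Measure ℕ) [IsFiniteMeasure ν] (A : Set ℕ) (k : ℕ) :
    ν.real (A ∩ Iio (k + 1)) = ν.real (A ∩ Iio k) + A.indicator 1 k * ν.real {k} := by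
  have hIio : Iio (k + 1) = Iio k ∪ {k} := by ext; simp [le_iff_lt_or_eq]
  rw [hIio, inter_union_distrib_left, measureReal_union
    (disjoint_left.2 (by simp +contextual [ne_of_lt])) (by simp)]
  by_cases hk : k ∈ A <;> simp [hk]

theorem measureReal_Iio_succ (ν : Measure ℕ) [IsFiniteMeasure ν] (k : ℕ) :
    ν.real (Iio (k + 1)) = ν.real (Iio k) + ν.real {k} := by
  simpa using measureReal_inter_Iio_succ ν univ k

theorem measureReal_Ici_eq_add (ν : Measure ℕ) [IsProbabilityMeasure ν] (k : ℕ) :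
    ν.real (Ici k) = ν.real {k} + ν.real (Ici (k + 1)) := by
  simp only [← compl_Iio, probReal_compl_eq_one_sub measurableSet_Iio, measureReal_Iio_succ]
  ring

theorem hasSum_poissonMeasure_real_Ici (Λ : ℝ≥0) (m : ℕ) :
    HasSum (fun i ↦ (poissonMeasure Λ).real {i + m}) ((poissonMeasure Λ).real (Ici m)) := by
  have htotal : HasSum (fun i ↦ (poissonMeasure Λ).real {i}) 1 := by
    simpa only [poissonMeasure_real_singleton] using hasSum_one_poissonMeasure Λ
  have hhead : ∑ i ∈ Finset.range m, (poissonMeasure Λ).real {i} =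
      (poissonMeasure Λ).real (Iio m) := by
    simp [← Finset.coe_range]
  rw [← compl_Iio, probReal_compl_eq_one_sub measurableSet_Iio, ← hhead]
  exact (hasSum_nat_add_iff' m).2 htotal

theorem sub_mul_poissonMeasure_real_Ici_le (Λ : ℝ≥0) (k : ℕ) :
    ((k : ℝ) - Λ) * (poissonMeasure Λ).real (Ici k) ≤ k * (poissonMeasure Λ).real {k} := by
  cases k with
  | zero => simp
  | succ m =>
    have htail : ((m : ℝ) + 1) * (poissonMeasure Λ).real (Ici (m + 1)) ≤
        Λ * (poissonMeasure Λ).real (Ici m) := by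
      refine hasSum_le (fun i ↦ ?_) ((hasSum_poissonMeasure_real_Ici Λ (m + 1)).mul_left _)
        ((hasSum_poissonMeasure_real_Ici Λ m).mul_left _)
      rw [← succ_mul_poissonMeasure_real_singleton_succ, ← add_assoc]
      gcongr
      simp
    rw [measureReal_Ici_eq_add _ m] at htail
    push_cast
    linarith [succ_mul_poissonMeasure_real_singleton_succ Λ m]

theorem sub_mul_poissonMeasure_real_Iio_le (Λ : ℝ≥0) (k : ℕ) :
    ((Λ : ℝ) - k) * (poissonMeasure Λ).real (Iio k) ≤ k * (poissonMeasure Λ).real {k} := by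
  induction k with
  | zero => simp
  | succ k ih =>
    have hrec := succ_mul_poissonMeasure_real_singleton_succ Λ k
    rw [measureReal_Iio_succ]
    push_cast
    nlinarith [measureReal_nonneg (μ := poissonMeasure Λ) (s := Iio k),
      measureReal_nonneg (μ := poissonMeasure Λ) (s := {k})]

/-- The function `g` on `ℕ` with `g 0 = 0` which solves the Stein equation
`Λ g (k + 1) - k g k = 1_A k - ν A` of the Poisson distribution `ν` with mean `Λ`. The value at `0`
comes from the convention `0 / 0 = 0`. -/
def poissonSteinSolution (Λ : ℝ≥0) (A : Set ℕ) (k : ℕ) : ℝ :=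
  ((poissonMeasure Λ).real (A ∩ Iio k) -
    (poissonMeasure Λ).real A * (poissonMeasure Λ).real (Iio k)) /
      (k * (poissonMeasure Λ).real {k})

theorem poissonSteinSolution_zero (Λ : ℝ≥0) (A : Set ℕ) : poissonSteinSolution Λ A 0 = 0 := by
  simp [poissonSteinSolution]

theorem poissonSteinSolution_compl (Λ : ℝ≥0) (A : Set ℕ) (k : ℕ) :
    poissonSteinSolution Λ Aᶜ k = -poissonSteinSolution Λ A k := by
  have hsplit := measureReal_inter_add_sdiff (μ := poissonMeasure Λ) (s := Iio k) (t := A)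
    (by measurability)
  rw [poissonSteinSolution, poissonSteinSolution, ← neg_div,
    probReal_compl_eq_one_sub (by measurability), inter_comm, ← sdiff_eq, inter_comm A]
  congr 1
  linarith

theorem poissonSteinSolution_equation {Λ : ℝ≥0} (hΛ : 0 < Λ) (A : Set ℕ) (k : ℕ) :
    Λ * poissonSteinSolution Λ A (k + 1) - k * poissonSteinSolution Λ A k =
      A.indicator 1 k - (poissonMeasure Λ).real A := by
  have hpos := poissonMeasure_real_singleton_pos k hΛ
  have hΛ' : (Λ : ℝ) ≠ 0 := by exact_mod_cast hΛ.ne'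
  rw [poissonSteinSolution, Nat.cast_succ, succ_mul_poissonMeasure_real_singleton_succ,
    measureReal_inter_Iio_succ, measureReal_Iio_succ, poissonSteinSolution]
  rcases Nat.eq_zero_or_pos k with rfl | hk
  · simp
    field_simp
  · field_simp
    ring

theorem sub_mul_poissonSteinSolution_le {Λ : ℝ≥0} (hΛ : 0 < Λ) (A : Set ℕ) (k : ℕ) :
    ((k : ℝ) - Λ) * poissonSteinSolution Λ A k ≤ (poissonMeasure Λ).real A := by
  set ν := poissonMeasure Λ
  rcases Nat.eq_zero_or_pos k with rfl | hk
  · simp [poissonSteinSolution_zero]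
  have hweight : 0 < k * ν.real {k} :=
    mul_pos (Nat.cast_pos.2 hk) (poissonMeasure_real_singleton_pos k hΛ)
  have hA : 0 ≤ ν.real A := measureReal_nonneg
  rw [poissonSteinSolution, mul_div_assoc', div_le_iff₀ hweight]
  rcases le_total (Λ : ℝ) k with hle | hle
  · have hIci : ν.real (Ici k) = 1 - ν.real (Iio k) := by
      rw [← compl_Iio, probReal_compl_eq_one_sub measurableSet_Iio]
    calc ((k : ℝ) - Λ) * (ν.real (A ∩ Iio k) - ν.real A * ν.real (Iio k))
        ≤ ((k : ℝ) - Λ) * (ν.real A - ν.real A * ν.real (Iio k)) := by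
          have hsub := measureReal_mono (μ := ν) (inter_subset_left (s := A) (t := Iio k))
          have := sub_nonneg.2 hle
          gcongr
      _ = ν.real A * (((k : ℝ) - Λ) * ν.real (Ici k)) := by rw [hIci]; ring
      _ ≤ ν.real A * (k * ν.real {k}) :=
          mul_le_mul_of_nonneg_left (sub_mul_poissonMeasure_real_Ici_le Λ k) hA
  · calc ((k : ℝ) - Λ) * (ν.real (A ∩ Iio k) - ν.real A * ν.real (Iio k))
        ≤ ν.real A * (((Λ : ℝ) - k) * ν.real (Iio k)) := by
          nlinarith [measureReal_nonneg (μ := ν) (s := A ∩ Iio k)]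
      _ ≤ ν.real A * (k * ν.real {k}) :=
          mul_le_mul_of_nonneg_left (sub_mul_poissonMeasure_real_Iio_le Λ k) hA

theorem poissonSteinSolution_succ_sub_le {Λ : ℝ≥0} (hΛ : 0 < Λ) (A : Set ℕ) (k : ℕ) :
    poissonSteinSolution Λ A (k + 1) - poissonSteinSolution Λ A k ≤ A.indicator 1 k / Λ := by
  rw [le_div_iff₀ (by exact_mod_cast hΛ)]
  linarith [poissonSteinSolution_equation hΛ A k, sub_mul_poissonSteinSolution_le hΛ A k]

theorem abs_poissonSteinSolution_succ_sub_le {Λ : ℝ≥0} (hΛ : 0 < Λ) (A : Set ℕ) (k : ℕ) :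
    |poissonSteinSolution Λ A (k + 1) - poissonSteinSolution Λ A k| ≤ 1 / Λ := by
  have hind : ∀ B : Set ℕ, B.indicator (1 : ℕ → ℝ) k / Λ ≤ 1 / Λ := fun B ↦ by
    gcongr
    exact indicator_le' (fun _ _ ↦ le_rfl) (fun _ _ ↦ zero_le_one) k
  have hcompl := poissonSteinSolution_succ_sub_le hΛ Aᶜ k
  rw [poissonSteinSolution_compl, poissonSteinSolution_compl] at hcompl
  rw [abs_le]
  constructor <;> linarith [hind A, hind Aᶜ, poissonSteinSolution_succ_sub_le hΛ A k]

theorem abs_poissonSteinSolution_le {Λ : ℝ≥0} (hΛ : 0 < Λ) (A : Set ℕ) (k : ℕ) :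
    |poissonSteinSolution Λ A k| ≤ k / Λ := by
  rw [← sub_zero (poissonSteinSolution Λ A k), ← poissonSteinSolution_zero Λ A,
    ← Finset.sum_range_sub]
  refine (Finset.abs_sum_le_sum_abs _ _).trans
    ((Finset.sum_le_card_nsmul _ _ _ fun i _ ↦
      abs_poissonSteinSolution_succ_sub_le hΛ A i).trans_eq ?_)
  simp [div_eq_mul_inv]

theorem poissonSteinSolution_nonneg_of_subset_Iio (Λ : ℝ≥0) {A : Set ℕ} {k : ℕ}
    (hA : A ⊆ Iio k) :
    0 ≤ poissonSteinSolution Λ A k := by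
  rw [poissonSteinSolution, inter_eq_left.2 hA, ← mul_one_sub]
  have : (poissonMeasure Λ).real (Iio k) ≤ 1 := measureReal_le_one
  have := sub_nonneg.2 this
  positivity

theorem sum_abs_poissonSteinSolution_succ_sub_le {Λ : ℝ≥0} (hΛ : 0 < Λ) {A : Set ℕ}
    (hA : A.Subsingleton) (N : ℕ) :
    ∑ k ∈ Finset.range N, |poissonSteinSolution Λ A (k + 1) - poissonSteinSolution Λ A k| ≤
      2 / Λ := by
  set g := poissonSteinSolution Λ A
  obtain ⟨M, hNM, hAM⟩ : ∃ M, N ≤ M ∧ A ⊆ Iio M := by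
    obtain ⟨b, hb⟩ := hA.finite.bddAbove
    exact ⟨max N (b + 1), le_max_left _ _, fun a ha ↦ by have := hb ha; simp; omega⟩
  have habs : ∀ k, |g (k + 1) - g k| ≤ -(g (k + 1) - g k) + 2 / Λ * A.indicator 1 k := fun k ↦ by
    have hΔ := poissonSteinSolution_succ_sub_le hΛ A k
    have hind : 0 ≤ A.indicator (1 : ℕ → ℝ) k / Λ :=
      div_nonneg (indicator_nonneg (fun _ _ ↦ zero_le_one) k) Λ.coe_nonneg
    calc |g (k + 1) - g k| ≤ -(g (k + 1) - g k) + 2 * (A.indicator 1 k / Λ) :=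
          abs_le.2 ⟨by linarith, by linarith⟩
      _ = -(g (k + 1) - g k) + 2 / Λ * A.indicator 1 k := by ring
  have hind : ∑ k ∈ Finset.range M, A.indicator (1 : ℕ → ℝ) k ≤ 1 := by
    classical
    rw [Finset.sum_indicator_eq_sum_filter]
    simpa using Finset.card_le_one.2 fun a ha b hb ↦
      hA (Finset.mem_filter.1 ha).2 (Finset.mem_filter.1 hb).2
  calc ∑ k ∈ Finset.range N, |g (k + 1) - g k|
      ≤ ∑ k ∈ Finset.range M, |g (k + 1) - g k| := by
        gcongr
    _ ≤ ∑ k ∈ Finset.range M, (-(g (k + 1) - g k) + 2 / Λ * A.indicator 1 k) := by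
        gcongr; exact habs _
    _ = -g M + 2 / Λ * ∑ k ∈ Finset.range M, A.indicator 1 k := by
        rw [Finset.sum_add_distrib, Finset.sum_neg_distrib, Finset.sum_range_sub, Finset.mul_sum,
          show g 0 = 0 from poissonSteinSolution_zero Λ A, sub_zero]
    _ ≤ -0 + 2 / Λ * 1 := by
        gcongr
        exact poissonSteinSolution_nonneg_of_subset_Iio Λ hAM
    _ = 2 / Λ := by ring

theorem sum_sq_poissonSteinSolution_succ_sub_le {Λ : ℝ≥0} (hΛ : 0 < Λ) {A : Set ℕ}
    (hA : A.Subsingleton) (N : ℕ) :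
    ∑ k ∈ Finset.range N, (poissonSteinSolution Λ A (k + 1) - poissonSteinSolution Λ A k) ^ 2 ≤
      2 / Λ ^ 2 := by
  set g := poissonSteinSolution Λ A
  calc ∑ k ∈ Finset.range N, (g (k + 1) - g k) ^ 2
      ≤ ∑ k ∈ Finset.range N, 1 / Λ * |g (k + 1) - g k| := by
        gcongr with k
        rw [← sq_abs, sq]
        gcongr
        exact abs_poissonSteinSolution_succ_sub_le hΛ A k
    _ ≤ 1 / Λ * (2 / Λ) := by
        rw [← Finset.mul_sum]
        gcongr
        exact sum_abs_poissonSteinSolution_succ_sub_le hΛ hA N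
    _ = 2 / Λ ^ 2 := by ring

end PoissonStein

section TranslatedPoisson

variable {μ v : ℝ} {A : Set ℤ}

instance isProbabilityMeasure_translatedPoisson (μ v : ℝ) :
    IsProbabilityMeasure (translatedPoisson μ v) :=
  Measure.isProbabilityMeasure_map .of_discrete

/-- The Stein solution of `TP(μ, v)` for the set `A`: that of the Poisson distribution, carried over
by the translation that defines `TP(μ, v)` and extended by `0` to the left of its support. -/
def translatedPoissonSteinSolution (μ v : ℝ) (A : Set ℤ) (w : ℤ) : ℝ :=
  poissonSteinSolution (v + Int.fract (μ - v)).toNNReal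
    ((fun k : ℕ ↦ (k : ℤ) + ⌊μ - v⌋) ⁻¹' A) (w - ⌊μ - v⌋).toNat

theorem translatedPoissonSteinSolution_of_le {w : ℤ} (hw : w ≤ ⌊μ - v⌋) :
    translatedPoissonSteinSolution μ v A w = 0 := by
  rw [translatedPoissonSteinSolution, Int.toNat_of_nonpos (by omega), poissonSteinSolution_zero]

theorem translatedPoissonSteinSolution_natCast_add_floor (k : ℕ) :
    translatedPoissonSteinSolution μ v A (k + ⌊μ - v⌋) =
      poissonSteinSolution (v + Int.fract (μ - v)).toNNReal
        ((fun k : ℕ ↦ (k : ℤ) + ⌊μ - v⌋) ⁻¹' A) k := by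
  simp [translatedPoissonSteinSolution]

theorem translatedPoissonSteinSolution_succ_natCast_add_floor (k : ℕ) :
    translatedPoissonSteinSolution μ v A (k + ⌊μ - v⌋ + 1) =
      poissonSteinSolution (v + Int.fract (μ - v)).toNNReal
        ((fun k : ℕ ↦ (k : ℤ) + ⌊μ - v⌋) ⁻¹' A) (k + 1) := by
  rw [← translatedPoissonSteinSolution_natCast_add_floor]
  push_cast
  ring_nf

theorem add_fract_toNNReal_pos (hv : 0 < v) : 0 < (v + Int.fract (μ - v)).toNNReal :=
  Real.toNNReal_pos.2 (add_pos_of_pos_of_nonneg hv (Int.fract_nonneg _))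

theorem le_add_fract_toNNReal : v ≤ (v + Int.fract (μ - v)).toNNReal :=
  (le_add_of_nonneg_right (Int.fract_nonneg _)).trans (Real.le_coe_toNNReal _)

theorem translatedPoissonSteinSolution_equation (hv : 0 < v) {w : ℤ} (hw : ⌊μ - v⌋ ≤ w) :
    A.indicator 1 w - (translatedPoisson μ v).real A =
      (v + Int.fract (μ - v)) * Δ_[1] (translatedPoissonSteinSolution μ v A) w -
        (w - μ) * translatedPoissonSteinSolution μ v A w := by
  obtain ⟨k, rfl⟩ : ∃ k : ℕ, w = k + ⌊μ - v⌋ := ⟨(w - ⌊μ - v⌋).toNat, by omega⟩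
  have hrate : 0 < v + Int.fract (μ - v) := add_pos_of_pos_of_nonneg hv (Int.fract_nonneg _)
  have hmass : (translatedPoisson μ v).real A =
      (poissonMeasure (v + Int.fract (μ - v)).toNNReal).real
        ((fun k : ℕ ↦ (k : ℤ) + ⌊μ - v⌋) ⁻¹' A) :=
    map_measureReal_apply .of_discrete .of_discrete
  have hind : A.indicator (1 : ℤ → ℝ) (k + ⌊μ - v⌋) =
      ((fun k : ℕ ↦ (k : ℤ) + ⌊μ - v⌋) ⁻¹' A).indicator 1 k := rfl
  rw [fwdDiff, translatedPoissonSteinSolution_natCast_add_floor,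
    translatedPoissonSteinSolution_succ_natCast_add_floor, hmass, hind,
    ← poissonSteinSolution_equation (add_fract_toNNReal_pos hv), Real.coe_toNNReal _ hrate.le]
  push_cast [Int.fract]
  ring

theorem fwdDiff_translatedPoissonSteinSolution_of_lt {w : ℤ} (hw : w < ⌊μ - v⌋) :
    Δ_[1] (translatedPoissonSteinSolution μ v A) w = 0 := by
  rw [fwdDiff, translatedPoissonSteinSolution_of_le (by omega),
    translatedPoissonSteinSolution_of_le hw.le, sub_zero]

theorem indicator_sub_translatedPoisson_eq (hv : 0 < v) (w : ℤ) :
    A.indicator 1 w - (translatedPoisson μ v).real A =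
      (v + Int.fract (μ - v)) * Δ_[1] (translatedPoissonSteinSolution μ v A) w -
        (w - μ) * translatedPoissonSteinSolution μ v A w +
        (Iio ⌊μ - v⌋).indicator (fun w ↦ A.indicator 1 w - (translatedPoisson μ v).real A) w := by
  rcases lt_or_ge w ⌊μ - v⌋ with hw | hw
  · rw [indicator_of_mem (mem_Iio.2 hw), fwdDiff_translatedPoissonSteinSolution_of_lt hw,
      translatedPoissonSteinSolution_of_le hw.le]
    ring
  · rw [indicator_of_notMem (notMem_Iio.2 hw), add_zero,
      translatedPoissonSteinSolution_equation hv hw]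

theorem abs_fwdDiff_translatedPoissonSteinSolution_le (hv : 0 < v) (w : ℤ) :
    |Δ_[1] (translatedPoissonSteinSolution μ v A) w| ≤ 1 / v := by
  rcases lt_or_ge w ⌊μ - v⌋ with hw | hw
  · rw [fwdDiff_translatedPoissonSteinSolution_of_lt hw, abs_zero]
    positivity
  · obtain ⟨k, rfl⟩ : ∃ k : ℕ, w = k + ⌊μ - v⌋ := ⟨(w - ⌊μ - v⌋).toNat, by omega⟩
    rw [fwdDiff, translatedPoissonSteinSolution_succ_natCast_add_floor,
      translatedPoissonSteinSolution_natCast_add_floor]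
    exact (abs_poissonSteinSolution_succ_sub_le (add_fract_toNNReal_pos hv) _ k).trans
      (one_div_le_one_div_of_le hv le_add_fract_toNNReal)

theorem abs_translatedPoissonSteinSolution_le (hv : 0 < v) (w : ℤ) :
    |translatedPoissonSteinSolution μ v A w| ≤ |(w : ℝ) - ⌊μ - v⌋| / v := by
  rcases lt_or_ge w ⌊μ - v⌋ with hw | hw
  · rw [translatedPoissonSteinSolution_of_le hw.le, abs_zero]
    positivity
  · obtain ⟨k, rfl⟩ : ∃ k : ℕ, w = k + ⌊μ - v⌋ := ⟨(w - ⌊μ - v⌋).toNat, by omega⟩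
    rw [translatedPoissonSteinSolution_natCast_add_floor]
    push_cast
    rw [add_sub_cancel_right, Nat.abs_cast]
    refine (abs_poissonSteinSolution_le (add_fract_toNNReal_pos hv) _ k).trans ?_
    gcongr
    exact le_add_fract_toNNReal

theorem sum_sq_fwdDiff_translatedPoissonSteinSolution_le (hv : 0 < v) (hA : A.Subsingleton)
    (s : Finset ℤ) :
    ∑ w ∈ s, Δ_[1] (translatedPoissonSteinSolution μ v A) w ^ 2 ≤ 2 / v ^ 2 := by
  set f : ℤ → ℝ := fun w ↦ Δ_[1] (translatedPoissonSteinSolution μ v A) w ^ 2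
  set shift : ℕ → ℤ := fun k ↦ (k : ℤ) + ⌊μ - v⌋
  have hshift : Function.Injective shift := fun a b h ↦ by simpa [shift] using h
  obtain ⟨N, hN⟩ : ∃ N, ∀ w ∈ s, (w - ⌊μ - v⌋).toNat < N :=
    ⟨s.sup (fun w ↦ (w - ⌊μ - v⌋).toNat) + 1, fun w hw ↦ Nat.lt_succ_of_le
      (Finset.le_sup (f := fun w ↦ (w - ⌊μ - v⌋).toNat) hw)⟩
  have hsupport : ∀ w ∈ s, w ∉ (Finset.range N).image shift → f w = 0 := fun w hw hwN ↦ by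
    have hlt : w < ⌊μ - v⌋ := by
      by_contra! hle
      exact hwN (Finset.mem_image.2 ⟨_, Finset.mem_range.2 (hN w hw), by simp [shift]; omega⟩)
    simp only [f, fwdDiff_translatedPoissonSteinSolution_of_lt hlt]
    exact zero_pow two_ne_zero
  calc ∑ w ∈ s, f w
      ≤ ∑ w ∈ (Finset.range N).image shift, f w :=
        (Finset.sum_le_sum_of_subset_of_nonneg Finset.subset_union_left
          fun _ _ _ ↦ sq_nonneg _).trans_eq
          (Finset.sum_subset Finset.subset_union_right fun w hw hwN ↦
            hsupport w (by grind) hwN).symm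
    _ = ∑ k ∈ Finset.range N, f (shift k) := Finset.sum_image hshift.injOn
    _ ≤ 2 / ((v + Int.fract (μ - v)).toNNReal : ℝ) ^ 2 := by
        simp only [f, shift, fwdDiff, translatedPoissonSteinSolution_succ_natCast_add_floor,
          translatedPoissonSteinSolution_natCast_add_floor]
        exact sum_sq_poissonSteinSolution_succ_sub_le (add_fract_toNNReal_pos hv)
          (hA.preimage hshift) N
    _ ≤ 2 / v ^ 2 := by
        gcongr
        exact le_add_fract_toNNReal

theorem abs_indicator_sub_translatedPoisson_le_one (w : ℤ) :
    |A.indicator 1 w - (translatedPoisson μ v).real A| ≤ 1 := by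
  have hnonneg : 0 ≤ (translatedPoisson μ v).real A := measureReal_nonneg
  have hle : (translatedPoisson μ v).real A ≤ 1 := measureReal_le_one
  by_cases hw : w ∈ A <;> simp only [hw, indicator_of_mem, indicator_of_notMem, not_false_eq_true,
    Pi.one_apply, abs_le] <;> constructor <;> linarith

theorem abs_indicator_Iio_floor_le (w : ℤ) :
    |(Iio ⌊μ - v⌋).indicator (fun w ↦ A.indicator 1 w - (translatedPoisson μ v).real A) w| ≤
      (Iio ⌊μ - v⌋).indicator 1 w := by
  by_cases hw : w ∈ Iio ⌊μ - v⌋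
  · simp only [indicator_of_mem hw]
    exact abs_indicator_sub_translatedPoisson_le_one w
  · simp only [indicator_of_notMem hw, abs_zero, le_refl]

end TranslatedPoisson

section Covariance

variable {Ω : Type*} [MeasurableSpace Ω] {P : Measure Ω}

theorem abs_covariance_le_sqrt_variance_mul_sqrt_variance [IsFiniteMeasure P] {X Y : Ω → ℝ}
    (hX : MemLp X 2 P) (hY : MemLp Y 2 P) :
    |cov[X, Y; P]| ≤ √(Var[X; P]) * √(Var[Y; P]) := by
  have hquadratic : ∀ t : ℝ, 0 ≤ Var[Y; P] * (t * t) + 2 * cov[X, Y; P] * t + Var[X; P] := fun t ↦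
    calc 0 ≤ Var[X + t • Y; P] := variance_nonneg _ _
      _ = Var[Y; P] * (t * t) + 2 * cov[X, Y; P] * t + Var[X; P] := by
        rw [variance_add hX (hY.const_smul t), covariance_smul_right, variance_smul]
        ring
  have hdiscrim := discrim_le_zero hquadratic
  rw [← Real.sqrt_mul (variance_nonneg X P)]
  refine Real.abs_le_sqrt ?_
  rw [discrim] at hdiscrim
  linarith

variable [IsProbabilityMeasure P]

theorem covariance_eq_integral_centered_mul {X Y : Ω → ℝ} (hX : MemLp X 2 P) (hY : MemLp Y 2 P) :
    cov[X, Y; P] = ∫ ω, (X ω - ∫ ω, X ω ∂P) * Y ω ∂P := by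
  have hXY : Integrable (fun ω ↦ X ω * Y ω) P := hX.integrable_mul hY
  simp only [sub_mul]
  rw [covariance_eq_sub hX hY, integral_sub hXY ((hY.integrable one_le_two).const_mul _),
    integral_const_mul]
  rfl

theorem sqrt_variance_le_of_abs_le {X : Ω → ℝ} (hX : AEMeasurable X P) {c : ℝ} (hc : 0 ≤ c)
    (hXc : ∀ ω, |X ω| ≤ c) : √(Var[X; P]) ≤ c := by
  refine Real.sqrt_le_iff.2 ⟨hc, ?_⟩
  simpa using variance_le_sq_of_bounded (ae_of_all P fun ω ↦ abs_le.1 (hXc ω)) hX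

theorem sqrt_variance_indicator_le_half {s : Set Ω} (hs : MeasurableSet s) :
    √(Var[s.indicator 1; P]) ≤ 1 / 2 := by
  have hmem : ∀ ω, s.indicator (1 : Ω → ℝ) ω ∈ Icc 0 1 := fun ω ↦
    ⟨indicator_nonneg (fun _ _ ↦ zero_le_one) ω,
      indicator_le' (fun _ _ ↦ le_rfl) (fun _ _ ↦ zero_le_one) ω⟩
  refine Real.sqrt_le_iff.2 ⟨by norm_num, ?_⟩
  simpa using variance_le_sq_of_bounded (ae_of_all P hmem) (by fun_prop)

end Covariance

section MaxPointProb

theorem maxPointProb_nonneg (ν : Measure ℤ) : 0 ≤ maxPointProb ν :=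
  Real.iSup_nonneg fun _ ↦ measureReal_nonneg

theorem measureReal_singleton_le_maxPointProb (ν : Measure ℤ) [IsProbabilityMeasure ν] (k : ℤ) :
    ν.real {k} ≤ maxPointProb ν :=
  le_ciSup (f := fun k ↦ ν.real {k}) ⟨1, by rintro _ ⟨k, rfl⟩; exact measureReal_le_one⟩ k

theorem integral_le_maxPointProb_mul (ν : Measure ℤ) [IsProbabilityMeasure ν] {f : ℤ → ℝ}
    (hf : ∀ k, 0 ≤ f k) {c : ℝ} (hfc : ∀ s : Finset ℤ, ∑ k ∈ s, f k ≤ c) :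
    ∫ k, f k ∂ν ≤ maxPointProb ν * c := by
  have hsum : Summable f := summable_of_sum_le hf hfc
  have hfin : Integrable f ν := by
    refine .of_bound .of_discrete c (ae_of_all _ fun k ↦ ?_)
    rw [Real.norm_of_nonneg (hf k)]
    simpa using hfc {k}
  have hmax := maxPointProb_nonneg ν
  have hle : ∀ k, ν.real {k} * f k ≤ maxPointProb ν * f k := fun k ↦
    mul_le_mul_of_nonneg_right (measureReal_singleton_le_maxPointProb ν k) (hf k)
  have hmaxsum := hsum.mul_left (maxPointProb ν)
  calc ∫ k, f k ∂ν = ∑' k, ν.real {k} * f k := integral_countable hfin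
    _ ≤ ∑' k, maxPointProb ν * f k :=
      (hmaxsum.of_nonneg_of_le (fun k ↦ mul_nonneg measureReal_nonneg (hf k)) hle).tsum_le_tsum
        hle hmaxsum
    _ = maxPointProb ν * ∑' k, f k := tsum_mul_left
    _ ≤ maxPointProb ν * c := by
      gcongr
      exact hsum.tsum_le_of_sum_le hfc

end MaxPointProb

/-- The Stein identity of an integer-valued `W` which moves up at rate `S` and regresses to its mean
at rate `lam`: the shape in which an exchangeable pair `(W, W')` with unit steps enters the
approximation of the law of `W`. -/
structure HasSteinIdentity {Ω : Type*} [MeasurableSpace Ω] (P : Measure Ω) (W : Ω → ℤ) (S : Ω → ℝ)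
    (lam : ℝ) : Prop where
  measurable : Measurable W
  memLp : MemLp (fun ω ↦ (W ω : ℝ)) 2 P
  memLp_rate : MemLp S 2 P
  pos : 0 < lam
  identity : ∀ g : ℤ → ℝ, MemLp (fun ω ↦ g (W ω)) 2 P →
    lam * cov[fun ω ↦ (W ω : ℝ), fun ω ↦ g (W ω); P] = ∫ ω, S ω * Δ_[1] g (W ω) ∂P

namespace HasSteinIdentity

variable {Ω : Type*} [MeasurableSpace Ω] {P : Measure Ω} {W : Ω → ℤ} {S : Ω → ℝ} {lam : ℝ}

theorem memLp_comp_of_abs_le [IsFiniteMeasure P] (h : HasSteinIdentity P W S lam)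
    {g : ℤ → ℝ} {c : ℝ} (hg : ∀ w, |g w| ≤ c) : MemLp (fun ω ↦ g (W ω)) 2 P :=
  .of_bound (Measurable.of_discrete.comp h.measurable).aestronglyMeasurable c
    (ae_of_all _ fun ω ↦ hg (W ω))

theorem integral_rate (h : HasSteinIdentity P W S lam) :
    ∫ ω, S ω ∂P = lam * Var[fun ω ↦ (W ω : ℝ); P] := by
  rw [← covariance_self h.memLp.aemeasurable, h.identity _ h.memLp]
  simp [fwdDiff]

theorem measureReal_map_eq_integral (h : HasSteinIdentity P W S lam) (A : Set ℤ) :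
    (P.map W).real A = ∫ ω, A.indicator 1 (W ω) ∂P := by
  rw [map_measureReal_apply h.measurable .of_discrete,
    ← integral_indicator_one (h.measurable .of_discrete)]
  rfl

variable [IsProbabilityMeasure P]

theorem covariance_eq_of_memLp (h : HasSteinIdentity P W S lam) {g : ℤ → ℝ}
    (hg : MemLp (fun ω ↦ g (W ω)) 2 P) (hΔg : MemLp (fun ω ↦ Δ_[1] g (W ω)) 2 P) :
    lam * cov[fun ω ↦ (W ω : ℝ), fun ω ↦ g (W ω); P] = cov[S, fun ω ↦ Δ_[1] g (W ω); P] +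
      lam * Var[fun ω ↦ (W ω : ℝ); P] * ∫ ω, Δ_[1] g (W ω) ∂P := by
  rw [h.identity g hg, covariance_eq_sub h.memLp_rate hΔg, h.integral_rate]
  simp only [Pi.mul_apply, sub_add_cancel]

theorem measureReal_map_singleton_le (h : HasSteinIdentity P W S lam)
    (hv : 0 < Var[fun ω ↦ (W ω : ℝ); P]) (k : ℤ) :
    (P.map W).real {k} ≤ (1 / √(Var[fun ω ↦ (W ω : ℝ); P]) +
      √(Var[S; P]) / (lam * Var[fun ω ↦ (W ω : ℝ); P])) / 2 := by
  set v := Var[fun ω ↦ (W ω : ℝ); P]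
  have hlam := h.pos
  have hmemLp : ∀ A : Set ℤ, MemLp ((W ⁻¹' A).indicator (1 : Ω → ℝ)) 2 P := fun A ↦
    memLp_indicator_const 2 (h.measurable .of_discrete) 1 (.inr (measure_ne_top _ _))
  have hstep : Δ_[1] ((Ioi k).indicator (1 : ℤ → ℝ)) = ({k} : Set ℤ).indicator 1 := by
    ext w
    simp only [fwdDiff, indicator_apply, mem_Ioi, mem_singleton_iff, Pi.one_apply]
    grind
  have hcov : lam * cov[fun ω ↦ (W ω : ℝ), (W ⁻¹' Ioi k).indicator 1; P] =
      cov[S, (W ⁻¹' {k}).indicator 1; P] + lam * v * (P.map W).real {k} := by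
    rw [map_measureReal_apply h.measurable .of_discrete,
      ← integral_indicator_one (h.measurable .of_discrete)]
    have hident := h.covariance_eq_of_memLp (g := (Ioi k).indicator 1) (hmemLp (Ioi k))
    rw [hstep] at hident
    exact hident (hmemLp {k})
  have hhalf : ∀ A : Set ℤ, √(Var[(W ⁻¹' A).indicator 1; P]) ≤ 1 / 2 := fun A ↦
    sqrt_variance_indicator_le_half (h.measurable .of_discrete)
  have hW := (abs_covariance_le_sqrt_variance_mul_sqrt_variance h.memLp (hmemLp (Ioi k))).trans
    (mul_le_mul_of_nonneg_left (hhalf _) (Real.sqrt_nonneg _))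
  have hS := (abs_covariance_le_sqrt_variance_mul_sqrt_variance h.memLp_rate (hmemLp {k})).trans
    (mul_le_mul_of_nonneg_left (hhalf _) (Real.sqrt_nonneg _))
  have hbound : lam * v * (P.map W).real {k} ≤ (lam * √v + √(Var[S; P])) / 2 := by
    nlinarith [(abs_le.1 hW).2, (abs_le.1 hS).1]
  calc (P.map W).real {k} ≤ (lam * √v + √(Var[S; P])) / 2 / (lam * v) := by
        rw [le_div_iff₀ (by positivity)]
        linarith
    _ = (1 / √v + √(Var[S; P]) / (lam * v)) / 2 := by
        rw [← Real.sqrt_div_self']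
        field_simp

variable {μ v : ℝ}

theorem measureReal_lt_floor_le (h : HasSteinIdentity P W S lam)
    (hμ : ∫ ω, (W ω : ℝ) ∂P = μ) (hvar : Var[fun ω ↦ (W ω : ℝ); P] = v) (hv : 0 < v) :
    P.real (W ⁻¹' Iio ⌊μ - v⌋) ≤ 1 / v := by
  have hsub : W ⁻¹' Iio ⌊μ - v⌋ ⊆ {ω | v ≤ |(W ω : ℝ) - μ|} := fun ω hω ↦ by
    have hlt : (W ω : ℝ) < μ - v := (Int.cast_lt.2 hω).trans_le (Int.floor_le _)
    change v ≤ |(W ω : ℝ) - μ|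
    exact le_abs.2 (.inr (by linarith))
  have hchebyshev := meas_ge_le_variance_div_sq h.memLp hv
  rw [hμ, hvar] at hchebyshev
  calc P.real (W ⁻¹' Iio ⌊μ - v⌋) ≤ P.real {ω | v ≤ |(W ω : ℝ) - μ|} := measureReal_mono hsub
    _ ≤ v / v ^ 2 := ENNReal.toReal_le_of_le_ofReal (by positivity) hchebyshev
    _ = 1 / v := by field_simp

theorem memLp_translatedPoissonSteinSolution (h : HasSteinIdentity P W S lam) (hv : 0 < v)
    (A : Set ℤ) : MemLp (fun ω ↦ translatedPoissonSteinSolution μ v A (W ω)) 2 P := by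
  have hlinear : MemLp (fun ω ↦ v⁻¹ * ((W ω : ℝ) - ⌊μ - v⌋)) 2 P :=
    (h.memLp.sub (memLp_const _)).const_mul v⁻¹
  refine hlinear.of_le (Measurable.of_discrete.comp h.measurable :
    Measurable (translatedPoissonSteinSolution μ v A ∘ W)).aestronglyMeasurable
    (ae_of_all _ fun ω ↦ ?_)
  rw [Real.norm_eq_abs, Real.norm_eq_abs, ← div_eq_inv_mul, abs_div, abs_of_pos hv]
  exact abs_translatedPoissonSteinSolution_le hv _

theorem measureReal_map_sub_translatedPoisson (h : HasSteinIdentity P W S lam)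
    (hμ : ∫ ω, (W ω : ℝ) ∂P = μ) (hvar : Var[fun ω ↦ (W ω : ℝ); P] = v) (hv : 0 < v)
    (A : Set ℤ) :
    (P.map W).real A - (translatedPoisson μ v).real A =
      Int.fract (μ - v) * ∫ ω, Δ_[1] (translatedPoissonSteinSolution μ v A) (W ω) ∂P -
        cov[S, fun ω ↦ Δ_[1] (translatedPoissonSteinSolution μ v A) (W ω); P] / lam +
        ∫ ω, (Iio ⌊μ - v⌋).indicator
          (fun w ↦ A.indicator 1 w - (translatedPoisson μ v).real A) (W ω) ∂P := by
  have hg := h.memLp_translatedPoissonSteinSolution (μ := μ) hv A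
  have hΔ := h.memLp_comp_of_abs_le
    (abs_fwdDiff_translatedPoissonSteinSolution_le (μ := μ) (A := A) hv)
  have hpointwise := indicator_sub_translatedPoisson_eq (μ := μ) (A := A) hv
  have hcov := h.covariance_eq_of_memLp hg hΔ
  have hcentered := covariance_eq_integral_centered_mul h.memLp hg
  rw [hvar] at hcov
  rw [hμ] at hcentered
  set T := (translatedPoisson μ v).real A
  set g := translatedPoissonSteinSolution μ v A
  set R : ℤ → ℝ := (Iio ⌊μ - v⌋).indicator fun w ↦ A.indicator 1 w - T
  have hA : MemLp (fun ω ↦ A.indicator (1 : ℤ → ℝ) (W ω)) 2 P :=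
    h.memLp_comp_of_abs_le (c := 1) fun w ↦ by by_cases hw : w ∈ A <;> simp [hw]
  have hR : MemLp (fun ω ↦ R (W ω)) 2 P := h.memLp_comp_of_abs_le (c := 1) fun w ↦
    (abs_indicator_Iio_floor_le w).trans
      (indicator_le' (fun _ _ ↦ le_rfl) (fun _ _ ↦ zero_le_one) w)
  have hWg : Integrable (fun ω ↦ ((W ω : ℝ) - μ) * g (W ω)) P :=
    (h.memLp.sub (memLp_const μ)).integrable_mul hg
  calc (P.map W).real A - T = ∫ ω, (A.indicator 1 (W ω) - T) ∂P := by
        rw [integral_sub (hA.integrable one_le_two) (integrable_const _),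
          h.measureReal_map_eq_integral]
        simp
    _ = (v + Int.fract (μ - v)) * ∫ ω, Δ_[1] g (W ω) ∂P -
          cov[fun ω ↦ (W ω : ℝ), fun ω ↦ g (W ω); P] + ∫ ω, R (W ω) ∂P := by
        simp only [hpointwise]
        rw [integral_add _ (hR.integrable one_le_two),
          integral_sub ((hΔ.integrable one_le_two).const_mul _) hWg, integral_const_mul, hcentered]
        exact ((hΔ.integrable one_le_two).const_mul _).sub hWg
    _ = _ := by
        have := h.pos.ne'
        field_simp
        linear_combination -hcov

theorem abs_measureReal_map_sub_translatedPoisson_le (h : HasSteinIdentity P W S lam)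
    (hμ : ∫ ω, (W ω : ℝ) ∂P = μ) (hvar : Var[fun ω ↦ (W ω : ℝ); P] = v) (hv : 0 < v)
    (A : Set ℤ) :
    |(P.map W).real A - (translatedPoisson μ v).real A| ≤
      √(Var[S; P]) * √(Var[fun ω ↦ Δ_[1] (translatedPoissonSteinSolution μ v A) (W ω); P]) / lam +
        2 / v := by
  set D : Ω → ℝ := fun ω ↦ Δ_[1] (translatedPoissonSteinSolution μ v A) (W ω)
  set R : ℤ → ℝ := (Iio ⌊μ - v⌋).indicator fun w ↦ A.indicator 1 w - (translatedPoisson μ v).real A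
  have hlam := h.pos
  have hD : ∀ ω, |D ω| ≤ 1 / v := fun ω ↦ abs_fwdDiff_translatedPoissonSteinSolution_le hv _
  have hfract : |Int.fract (μ - v) * ∫ ω, D ω ∂P| ≤ 1 / v := by
    rw [abs_mul, abs_of_nonneg (Int.fract_nonneg _), ← one_mul (1 / v)]
    refine mul_le_mul (Int.fract_lt_one _).le ?_ (abs_nonneg _) zero_le_one
    simpa using norm_integral_le_of_norm_le_const (μ := P) (f := D) (ae_of_all P hD)
  have hcov : |cov[S, D; P] / lam| ≤ √(Var[S; P]) * √(Var[D; P]) / lam := by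
    rw [abs_div, abs_of_pos hlam]
    gcongr
    exact abs_covariance_le_sqrt_variance_mul_sqrt_variance h.memLp_rate
      (h.memLp_comp_of_abs_le (abs_fwdDiff_translatedPoissonSteinSolution_le hv))
  have hrem : |∫ ω, R (W ω) ∂P| ≤ 1 / v := by
    have hL : MeasurableSet (W ⁻¹' Iio ⌊μ - v⌋) := h.measurable .of_discrete
    calc |∫ ω, R (W ω) ∂P| ≤ ∫ ω, (W ⁻¹' Iio ⌊μ - v⌋).indicator 1 ω ∂P :=
          norm_integral_le_of_norm_le (f := fun ω ↦ R (W ω))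
            (g := (W ⁻¹' Iio ⌊μ - v⌋).indicator 1)
            ((integrable_const 1).indicator hL)
            (ae_of_all P fun ω ↦ abs_indicator_Iio_floor_le (W ω))
      _ = P.real (W ⁻¹' Iio ⌊μ - v⌋) := integral_indicator_one hL
      _ ≤ 1 / v := h.measureReal_lt_floor_le hμ hvar hv
  rw [h.measureReal_map_sub_translatedPoisson hμ hvar hv]
  calc _ ≤ |Int.fract (μ - v) * ∫ ω, D ω ∂P| + |cov[S, D; P] / lam| + |∫ ω, R (W ω) ∂P| :=
        (abs_add_le _ _).trans (add_le_add_left (abs_sub _ _) _)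
    _ ≤ 1 / v + √(Var[S; P]) * √(Var[D; P]) / lam + 1 / v := by gcongr
    _ = _ := by ring

theorem tvDistInt_translatedPoisson_le (h : HasSteinIdentity P W S lam)
    (hμ : ∫ ω, (W ω : ℝ) ∂P = μ) (hvar : Var[fun ω ↦ (W ω : ℝ); P] = v) (hv : 0 < v) :
    tvDistInt (P.map W) (translatedPoisson μ v) ≤ √(Var[S; P]) / (lam * v) + 2 / v := by
  have hlam := h.pos
  refine ciSup_le fun A ↦ (h.abs_measureReal_map_sub_translatedPoisson_le hμ hvar hv A).trans ?_
  calc _ ≤ √(Var[S; P]) * (1 / v) / lam + 2 / v := by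
        gcongr
        exact sqrt_variance_le_of_abs_le
          (h.memLp_comp_of_abs_le (abs_fwdDiff_translatedPoissonSteinSolution_le hv)).aemeasurable
          (by positivity) fun ω ↦ abs_fwdDiff_translatedPoissonSteinSolution_le hv _
    _ = _ := by field_simp

theorem variance_fwdDiff_translatedPoissonSteinSolution_le (h : HasSteinIdentity P W S lam)
    (hv : 0 < v) (hA : A.Subsingleton) :
    Var[fun ω ↦ Δ_[1] (translatedPoissonSteinSolution μ v A) (W ω); P] ≤
      maxPointProb (P.map W) * (2 / v ^ 2) := by
  have := Measure.isProbabilityMeasure_map h.measurable.aemeasurable (μ := P)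
  have hmemLp := h.memLp_comp_of_abs_le
    (abs_fwdDiff_translatedPoissonSteinSolution_le (μ := μ) (A := A) hv)
  calc _ ≤ ∫ ω, Δ_[1] (translatedPoissonSteinSolution μ v A) (W ω) ^ 2 ∂P :=
        variance_le_expectation_sq hmemLp.aestronglyMeasurable
    _ = ∫ w, Δ_[1] (translatedPoissonSteinSolution μ v A) w ^ 2 ∂(P.map W) :=
        (integral_map h.measurable.aemeasurable
          (Measurable.of_discrete (f := fun w ↦ Δ_[1] (translatedPoissonSteinSolution μ v A) w ^ 2)
            ).aestronglyMeasurable).symm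
    _ ≤ _ := integral_le_maxPointProb_mul _ (fun _ ↦ sq_nonneg _)
        (sum_sq_fwdDiff_translatedPoissonSteinSolution_le hv hA)

theorem locDistInt_translatedPoisson_le (h : HasSteinIdentity P W S lam)
    (hμ : ∫ ω, (W ω : ℝ) ∂P = μ) (hvar : Var[fun ω ↦ (W ω : ℝ); P] = v) (hv : 0 < v) :
    locDistInt (P.map W) (translatedPoisson μ v) ≤
      2 * √(maxPointProb (P.map W) * Var[S; P]) / (lam * v) + 2 / v := by
  have hlam := h.pos
  set q := maxPointProb (P.map W)
  have hq : 0 ≤ q := maxPointProb_nonneg _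
  have hsqrt : √(q * (2 / v ^ 2)) ≤ 2 * √q / v := by
    refine Real.sqrt_le_iff.2 ⟨by positivity, ?_⟩
    calc q * (2 / v ^ 2) = 2 * (q / v ^ 2) := by ring
      _ ≤ 4 * (q / v ^ 2) := by
        gcongr
        norm_num
      _ = (2 * √q / v) ^ 2 := by
        rw [div_pow, mul_pow, Real.sq_sqrt hq]
        ring
  refine ciSup_le fun k ↦ (h.abs_measureReal_map_sub_translatedPoisson_le hμ hvar hv {k}).trans ?_
  calc _ ≤ √(Var[S; P]) * (2 * √q / v) / lam + 2 / v := by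
        gcongr
        exact (Real.sqrt_le_sqrt (h.variance_fwdDiff_translatedPoissonSteinSolution_le hv
          subsingleton_singleton)).trans hsqrt
    _ = _ := by
        rw [Real.sqrt_mul' _ (variance_nonneg _ _)]
        field_simp

end HasSteinIdentity

section ExchangeablePair

variable {Ω : Type*} [MeasurableSpace Ω] {P : Measure Ω} {W W' : Ω → ℤ}

theorem measureReal_up_eq_measureReal_down [IsFiniteMeasure P] (hW : Measurable W)
    (hW' : Measurable W') (hlaw : P.map W' = P.map W) (hstep : ∀ᵐ ω ∂P, |W' ω - W ω| ≤ 1) (a : ℤ) :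
    P.real {ω | W ω = a ∧ W' ω = a + 1} = P.real {ω | W ω = a + 1 ∧ W' ω = a} := by
  have hle : P.real (W' ⁻¹' Iic a) = P.real (W ⁻¹' Iic a) := by
    rw [← map_measureReal_apply hW' .of_discrete, hlaw, map_measureReal_apply hW .of_discrete]
  have hup : P.real {ω | W ω = a ∧ W' ω = a + 1} = P.real (W ⁻¹' Iic a \ W' ⁻¹' Iic a) := by
    refine measureReal_congr ?_
    filter_upwards [hstep] with ω hω
    rw [abs_le] at hω
    exact propext (show (W ω = a ∧ W' ω = a + 1) ↔ (W ω ≤ a ∧ ¬W' ω ≤ a) by omega)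
  have hdown : P.real {ω | W ω = a + 1 ∧ W' ω = a} = P.real (W' ⁻¹' Iic a \ W ⁻¹' Iic a) := by
    refine measureReal_congr ?_
    filter_upwards [hstep] with ω hω
    rw [abs_le] at hω
    exact propext (show (W ω = a + 1 ∧ W' ω = a) ↔ (W' ω ≤ a ∧ ¬W ω ≤ a) by omega)
  have hsplit := measureReal_inter_add_sdiff (μ := P) (s := W ⁻¹' Iic a)
    (hW' (.of_discrete : MeasurableSet (Iic a)))
  have hsplit' := measureReal_inter_add_sdiff (μ := P) (s := W' ⁻¹' Iic a)
    (hW (.of_discrete : MeasurableSet (Iic a)))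
  rw [inter_comm] at hsplit'
  linarith

theorem measureReal_pair_comm_of_abs_sub_le_one [IsFiniteMeasure P] (hW : Measurable W)
    (hW' : Measurable W') (hlaw : P.map W' = P.map W) (hstep : ∀ᵐ ω ∂P, |W' ω - W ω| ≤ 1)
    (a b : ℤ) : P.real {ω | W ω = a ∧ W' ω = b} = P.real {ω | W ω = b ∧ W' ω = a} := by
  have hnull : ∀ a b : ℤ, 1 < |b - a| → P.real {ω | W ω = a ∧ W' ω = b} = 0 := fun a b hab ↦ by
    rw [measureReal_eq_zero_iff, measure_eq_zero_iff_ae_notMem]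
    filter_upwards [hstep] with ω hω ⟨ha, hb⟩
    rw [ha, hb] at hω
    exact hω.not_gt hab
  rcases lt_or_ge 1 |b - a| with hab | hab
  · rw [hnull a b hab, hnull b a (abs_sub_comm b a ▸ hab)]
  rw [abs_le] at hab
  obtain rfl | rfl | rfl : b = a ∨ b = a + 1 ∨ a = b + 1 := by omega
  · rfl
  · exact measureReal_up_eq_measureReal_down hW hW' hlaw hstep a
  · exact (measureReal_up_eq_measureReal_down hW hW' hlaw hstep b).symm

theorem map_prodMk_comm_of_abs_sub_le_one [IsFiniteMeasure P] (hW : Measurable W)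
    (hW' : Measurable W') (hlaw : P.map W' = P.map W) (hstep : ∀ᵐ ω ∂P, |W' ω - W ω| ≤ 1) :
    P.map (fun ω ↦ (W ω, W' ω)) = P.map (fun ω ↦ (W' ω, W ω)) := by
  refine Measure.ext_of_singleton fun ⟨a, b⟩ ↦ ?_
  have hpair : ∀ X Y : Ω → ℤ, (fun ω ↦ (X ω, Y ω)) ⁻¹' {(a, b)} = {ω | X ω = a ∧ Y ω = b} :=
    fun X Y ↦ by ext ω; simp
  rw [Measure.map_apply (hW.prodMk hW') (measurableSet_singleton _),
    Measure.map_apply (hW'.prodMk hW) (measurableSet_singleton _), hpair, hpair,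
    ← measureReal_eq_measureReal_iff, measureReal_pair_comm_of_abs_sub_le_one hW hW' hlaw hstep]
  simp only [and_comm]

theorem integral_comp_swap (hW : Measurable W) (hW' : Measurable W')
    (hex : P.map (fun ω ↦ (W ω, W' ω)) = P.map (fun ω ↦ (W' ω, W ω))) (F : ℤ × ℤ → ℝ) :
    ∫ ω, F (W ω, W' ω) ∂P = ∫ ω, F (W' ω, W ω) ∂P := by
  rw [← integral_map (φ := fun ω ↦ (W ω, W' ω)) (f := F) (hW.prodMk hW').aemeasurable .of_discrete,
    hex, integral_map (hW'.prodMk hW).aemeasurable .of_discrete]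

theorem memLp_comp_of_map_eq (hW : Measurable W) (hW' : Measurable W') (hlaw : P.map W' = P.map W)
    {g : ℤ → ℝ} (hg : MemLp (fun ω ↦ g (W ω)) 2 P) : MemLp (fun ω ↦ g (W' ω)) 2 P := by
  rw [← Function.comp_def, ← memLp_map_measure_iff .of_discrete hW'.aemeasurable, hlaw]
  exact (memLp_map_measure_iff .of_discrete hW.aemeasurable).2 hg

theorem integral_mul_comp_eq_integral_condExp_mul_comp [IsFiniteMeasure P] (hW : Measurable W)
    {f : Ω → ℝ} (hf : Integrable f P) {g : ℤ → ℝ} (hfg : Integrable (fun ω ↦ f ω * g (W ω)) P) :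
    ∫ ω, f ω * g (W ω) ∂P = ∫ ω, (P[f | MeasurableSpace.comap W ⊤]) ω * g (W ω) ∂P := by
  have hg : StronglyMeasurable[MeasurableSpace.comap W ⊤] fun ω ↦ g (W ω) :=
    (Measurable.of_discrete.comp (comap_measurable W)).stronglyMeasurable
  rw [← integral_condExp hW.comap_le]
  exact integral_congr_ae (condExp_mul_of_stronglyMeasurable_right hg hfg hf)

theorem integral_sub_mul_comp_eq_setIntegral_fwdDiff (hW : Measurable W) (hW' : Measurable W')
    (hex : P.map (fun ω ↦ (W ω, W' ω)) = P.map (fun ω ↦ (W' ω, W ω)))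
    (hstep : ∀ᵐ ω ∂P, |W' ω - W ω| ≤ 1) {g : ℤ → ℝ} (hg : Integrable (fun ω ↦ g (W ω)) P)
    (hg' : Integrable (fun ω ↦ g (W' ω)) P) :
    ∫ ω, ((W ω : ℝ) - W' ω) * g (W ω) ∂P = ∫ ω in {ω | W' ω = W ω + 1}, Δ_[1] g (W ω) ∂P := by
  have hup : MeasurableSet {ω | W' ω = W ω + 1} := measurableSet_eq_fun hW' (hW.add_const 1)
  have hdown : MeasurableSet {ω | W ω = W' ω + 1} := measurableSet_eq_fun hW (hW'.add_const 1)
  have hswap : ∫ ω in {ω | W ω = W' ω + 1}, g (W ω) ∂P =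
      ∫ ω in {ω | W' ω = W ω + 1}, g (W' ω) ∂P := by
    rw [← integral_indicator hup, ← integral_indicator hdown]
    exact integral_comp_swap hW hW' hex
      ({p : ℤ × ℤ | p.1 = p.2 + 1}.indicator fun p ↦ g p.1)
  calc ∫ ω, ((W ω : ℝ) - W' ω) * g (W ω) ∂P
      = ∫ ω, ({ω | W ω = W' ω + 1}.indicator (fun ω ↦ g (W ω)) ω -
          {ω | W' ω = W ω + 1}.indicator (fun ω ↦ g (W ω)) ω) ∂P := by
        refine integral_congr_ae ?_
        filter_upwards [hstep] with ω hω
        rw [abs_le] at hω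
        obtain h | h | h : W' ω = W ω ∨ W' ω = W ω + 1 ∨ W ω = W' ω + 1 := by omega
        · simp [indicator, h]
        · have hne : W ω ≠ W ω + 1 + 1 := by omega
          simp [indicator, h, hne]
        · have hne : W' ω ≠ W' ω + 1 + 1 := by omega
          simp [indicator, h, hne]
    _ = ∫ ω in {ω | W' ω = W ω + 1}, (g (W' ω) - g (W ω)) ∂P := by
        rw [integral_sub (hg.indicator hdown) (hg.indicator hup), integral_indicator hup,
          integral_indicator hdown, hswap, integral_sub hg'.integrableOn hg.integrableOn]
    _ = ∫ ω in {ω | W' ω = W ω + 1}, Δ_[1] g (W ω) ∂P :=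
        setIntegral_congr_fun hup fun ω hω ↦ by
          rw [fwdDiff, ← show W' ω = W ω + 1 from hω]

theorem mul_covariance_eq_integral_sub_mul [IsProbabilityMeasure P] (hW : Measurable W)
    (hWmem : MemLp (fun ω ↦ (W ω : ℝ)) 2 P) (hWmem' : MemLp (fun ω ↦ (W' ω : ℝ)) 2 P) {lam : ℝ}
    (hreg : P[fun ω ↦ (W' ω : ℝ) - ∫ ω, (W ω : ℝ) ∂P | MeasurableSpace.comap W ⊤] =ᵐ[P]
      fun ω ↦ (1 - lam) * ((W ω : ℝ) - ∫ ω, (W ω : ℝ) ∂P))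
    {g : ℤ → ℝ} (hg : MemLp (fun ω ↦ g (W ω)) 2 P) :
    lam * cov[fun ω ↦ (W ω : ℝ), fun ω ↦ g (W ω); P] =
      ∫ ω, ((W ω : ℝ) - W' ω) * g (W ω) ∂P := by
  set μ := ∫ ω, (W ω : ℝ) ∂P
  have hcentered : ∀ {X : Ω → ℤ}, MemLp (fun ω ↦ (X ω : ℝ)) 2 P →
      MemLp (fun ω ↦ (X ω : ℝ) - μ) 2 P := fun hX ↦ hX.sub (memLp_const μ)
  have hint : Integrable (fun ω ↦ ((W ω : ℝ) - μ) * g (W ω)) P :=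
    (hcentered hWmem).integrable_mul hg
  have hint' : Integrable (fun ω ↦ ((W' ω : ℝ) - μ) * g (W ω)) P :=
    (hcentered hWmem').integrable_mul hg
  have hregress : ∫ ω, ((W' ω : ℝ) - μ) * g (W ω) ∂P =
      (1 - lam) * ∫ ω, ((W ω : ℝ) - μ) * g (W ω) ∂P := by
    rw [integral_mul_comp_eq_integral_condExp_mul_comp hW
      ((hcentered hWmem').integrable one_le_two) hint', ← integral_const_mul]
    refine integral_congr_ae ?_
    filter_upwards [hreg] with ω hω
    rw [hω, mul_assoc]
  rw [covariance_eq_integral_centered_mul hWmem hg]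
  calc lam * ∫ ω, ((W ω : ℝ) - μ) * g (W ω) ∂P
      = ∫ ω, ((W ω : ℝ) - μ) * g (W ω) ∂P - ∫ ω, ((W' ω : ℝ) - μ) * g (W ω) ∂P := by
        rw [hregress]
        ring
    _ = ∫ ω, ((W ω : ℝ) - W' ω) * g (W ω) ∂P := by
        rw [← integral_sub hint hint']
        congr! 2
        ring

theorem hasSteinIdentity_of_exchangeable [IsProbabilityMeasure P] (hW : Measurable W)
    (hW' : Measurable W') (hWmem : MemLp (fun ω ↦ (W ω : ℝ)) 2 P)
    (hex : P.map (fun ω ↦ (W ω, W' ω)) = P.map (fun ω ↦ (W' ω, W ω)))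
    (hstep : ∀ᵐ ω ∂P, |W' ω - W ω| ≤ 1) {lam : ℝ} (hlam : 0 < lam)
    (hreg : P[fun ω ↦ (W' ω : ℝ) - ∫ ω, (W ω : ℝ) ∂P | MeasurableSpace.comap W ⊤] =ᵐ[P]
      fun ω ↦ (1 - lam) * ((W ω : ℝ) - ∫ ω, (W ω : ℝ) ∂P)) :
    HasSteinIdentity P W (P[{ω | W' ω = W ω + 1}.indicator (fun _ ↦ (1 : ℝ)) |
      MeasurableSpace.comap W ⊤]) lam := by
  have hup : MeasurableSet {ω | W' ω = W ω + 1} := measurableSet_eq_fun hW' (hW.add_const 1)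
  have hlaw : P.map W' = P.map W := by
    have h := congrArg (Measure.map Prod.snd) hex
    rwa [Measure.map_map measurable_snd (hW.prodMk hW'),
      Measure.map_map measurable_snd (hW'.prodMk hW)] at h
  have hind : MemLp ({ω | W' ω = W ω + 1}.indicator fun _ ↦ (1 : ℝ)) 2 P :=
    memLp_indicator_const 2 hup 1 (.inr (measure_ne_top _ _))
  refine ⟨hW, hWmem, hind.condExp one_le_two, hlam, fun g hg ↦ ?_⟩
  have hgint := hg.integrable one_le_two
  have hgint' := (memLp_comp_of_map_eq hW hW' hlaw hg).integrable one_le_two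
  rw [mul_covariance_eq_integral_sub_mul hW hWmem (memLp_comp_of_map_eq hW hW' hlaw hWmem) hreg hg,
    integral_sub_mul_comp_eq_setIntegral_fwdDiff hW hW' hex hstep hgint hgint']
  have hΔ : IntegrableOn (fun ω ↦ Δ_[1] g (W ω)) {ω | W' ω = W ω + 1} P :=
    (hgint'.sub hgint).integrableOn.congr_fun
      (fun ω hω ↦ by simp only [Pi.sub_apply, fwdDiff, show W' ω = W ω + 1 from hω]) hup
  have hmul : (fun ω ↦ {ω | W' ω = W ω + 1}.indicator (fun _ ↦ (1 : ℝ)) ω * Δ_[1] g (W ω)) =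
      {ω | W' ω = W ω + 1}.indicator fun ω ↦ Δ_[1] g (W ω) := by
    ext ω
    simp only [indicator_apply, ite_mul, one_mul, zero_mul]
  rw [← integral_mul_comp_eq_integral_condExp_mul_comp hW (hind.integrable one_le_two), hmul,
    integral_indicator hup]
  rwa [hmul, integrable_indicator_iff hup]

end ExchangeablePair

section InvariantVector

variable {X : Type*} [Fintype X] {K : Matrix X X ℝ} {ν f g : X → ℝ}

theorem eq_zero_of_mulVec_eq_add (hν : 0 ≤ ν) (hK : ν ᵥ* K = ν) (hf : K *ᵥ f = f + g)
    (hg : 0 ≤ g) {x : X} (hx : 0 < ν x) : g x = 0 := by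
  have hsum : ν ⬝ᵥ g = 0 := by
    have h := Matrix.dotProduct_mulVec ν K f
    rw [hK, hf, dotProduct_add] at h
    linarith
  have hzero := (Finset.sum_eq_zero_iff_of_nonneg
    fun x _ ↦ mul_nonneg (hν x) (hg x)).1 hsum x (Finset.mem_univ x)
  exact (mul_eq_zero.1 hzero).resolve_left hx.ne'

variable [DecidableEq X]

theorem pos_of_vecMul_eq_of_pos (hK : K ∈ Matrix.rowStochastic ℝ X) (hν : ν ᵥ* K = ν) {x y : X}
    (hx : 0 < ν x) (hxy : 0 < K x y) : 0 < ν y := by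
  have hnn : ∀ x y, 0 ≤ K x y := fun _ _ ↦ Matrix.nonneg_of_mem_rowStochastic hK
  -- The positive part of `ν` is sub-invariant and has the same mass as its image: it is invariant.
  have hle : ν⁺ ≤ ν⁺ ᵥ* K := fun z ↦ by
    refine sup_le ?_ (Finset.sum_nonneg fun w _ ↦ mul_nonneg (posPart_nonneg ν w) (hnn w z))
    nth_rw 1 [← hν]
    exact Finset.sum_le_sum fun w _ ↦ mul_le_mul_of_nonneg_right (le_posPart ν w) (hnn w z)
  have hmass : ∑ z, ν⁺ z = ∑ z, (ν⁺ ᵥ* K) z := by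
    have h := Matrix.dotProduct_mulVec ν⁺ K 1
    rw [(Matrix.mem_rowStochastic.1 hK).2] at h
    simpa only [dotProduct_one] using h
  have hinv := (Finset.sum_eq_sum_iff_of_le fun z _ ↦ hle z).1 hmass y (Finset.mem_univ y)
  have hpos : 0 < ν⁺ y := by
    rw [hinv]
    exact Finset.sum_pos' (fun w _ ↦ mul_nonneg (posPart_nonneg ν w) (hnn w y))
      ⟨x, Finset.mem_univ x, mul_pos (hx.trans_le (le_posPart ν x)) hxy⟩
  simpa using hpos

theorem pos_of_vecMul_eq_of_reflTransGen (hK : K ∈ Matrix.rowStochastic ℝ X) (hν : ν ᵥ* K = ν)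
    {x y : X} (hx : 0 < ν x) (hxy : Relation.ReflTransGen (fun x y ↦ 0 < K x y) x y) :
    0 < ν y := by
  induction hxy with
  | refl => exact hx
  | tail _ h ih => exact pos_of_vecMul_eq_of_pos hK hν ih h

theorem nonneg_of_join_of_pos (hK : K ∈ Matrix.rowStochastic ℝ X) (hν : ν ᵥ* K = ν) {x y : X}
    (hx : 0 < ν x) (hxy : Relation.Join (Relation.ReflTransGen fun x y ↦ 0 < K x y) x y) :
    0 ≤ ν y := by
  obtain ⟨z, hxz, hyz⟩ := hxy
  by_contra! hy
  have hpos := pos_of_vecMul_eq_of_reflTransGen hK hν hx hxz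
  have hneg := pos_of_vecMul_eq_of_reflTransGen (ν := -ν) hK (by rw [Matrix.neg_vecMul, hν])
    (neg_pos.2 hy) hyz
  exact absurd hneg (by simpa using hpos.le)

end InvariantVector

section OddClosedWalk

variable {V : Type*} {G : SimpleGraph V}

variable (G) in
/-- The vertex lies on a closed walk of odd length, that is, its connected component is not
bipartite. -/
def OnOddClosedWalk (v : V) : Prop := ∃ p : G.Walk v v, Odd p.length

theorem OnOddClosedWalk.of_adj {u v : V} (h : G.Adj u v) (hu : OnOddClosedWalk G u) :
    OnOddClosedWalk G v := by
  obtain ⟨p, hp⟩ := hu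
  refine ⟨.cons h.symm (p.concat h), ?_⟩
  rw [Walk.length_cons, Walk.length_concat]
  exact hp.add_even even_two

theorem onOddClosedWalk_iff_of_adj {u v : V} (h : G.Adj u v) :
    OnOddClosedWalk G u ↔ OnOddClosedWalk G v :=
  ⟨.of_adj h, .of_adj h.symm⟩

variable (G) in
theorem two_colorable_off_onOddClosedWalk :
    ∃ C : V → Fin 2, ∀ i j, G.Adj i j → ¬ OnOddClosedWalk G i → C i ≠ C j := by
  let H : SimpleGraph V :=
    { Adj := fun a b ↦ G.Adj a b ∧ ¬ OnOddClosedWalk G a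
      symm := ⟨fun a b h ↦ ⟨h.1.symm, mt (onOddClosedWalk_iff_of_adj h.1).2 h.2⟩⟩
      loopless := ⟨fun a h ↦ G.loopless.irrefl a h.1⟩ }
  have hH : H.Colorable 2 := by
    rw [two_colorable_iff_forall_loop_even]
    intro u w
    by_contra hw
    rw [Nat.not_even_iff_odd] at hw
    have hG : OnOddClosedWalk G u :=
      ⟨w.mapLe (show H ≤ G from fun _ _ h ↦ h.1), by simpa using hw⟩
    cases w with
    | nil => simp at hw
    | cons h p => exact h.2 hG
  obtain ⟨C⟩ := hH
  exact ⟨C, fun i j hij hi ↦ C.valid ⟨hij, hi⟩⟩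

variable (G) in
theorem exists_alternating_eq_zero_iff_onOddClosedWalk :
    ∃ d : V → ℝ, (∀ v, d v = 0 ↔ OnOddClosedWalk G v) ∧ ∀ i j, G.Adj i j → d i = -d j := by
  classical
  obtain ⟨C, hC⟩ := two_colorable_off_onOddClosedWalk G
  refine ⟨fun v ↦ if OnOddClosedWalk G v then 0 else if C v = 0 then 1 else -1,
    fun v ↦ by by_cases hv : C v = 0 <;> simp [hv], fun i j hij ↦ ?_⟩
  by_cases hi : OnOddClosedWalk G i
  · simp only [hi, (onOddClosedWalk_iff_of_adj hij).1 hi, if_true, neg_zero]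
  · have hne := hC i j hij hi
    have hj := mt (onOddClosedWalk_iff_of_adj hij).2 hi
    by_cases h : C i = 0 <;> by_cases h' : C j = 0 <;> simp [hi, hj, h, h']
    all_goals omega

open Classical in
variable (G) in
/-- Reverse the opinions of all vertices that lie on a closed walk of odd length. -/
def flipOdd (x : V → Bool) (v : V) : Bool :=
  if OnOddClosedWalk G v then !x v else x v

theorem flipOdd_involutive : Function.Involutive (flipOdd G) := fun x ↦ by
  ext v
  by_cases h : OnOddClosedWalk G v <;> simp [flipOdd, h]

theorem flipOdd_update [DecidableEq V] {i j : V} (h : G.Adj i j) (x : V → Bool) :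
    flipOdd G (Function.update x i (!x j)) =
      Function.update (flipOdd G x) i (!flipOdd G x j) := by
  ext v
  rcases eq_or_ne v i with rfl | hv
  · by_cases hv : OnOddClosedWalk G v
    · simp [flipOdd, hv, (onOddClosedWalk_iff_of_adj h).1 hv]
    · simp [flipOdd, hv, mt (onOddClosedWalk_iff_of_adj h).2 hv]
  · simp [flipOdd, Function.update_of_ne hv]

end OddClosedWalk

section AntiVoterStep

variable {V : Type*} [DecidableEq V] {G : SimpleGraph V}

variable (G) in
/-- `AntiVoterStep G x y`: the state `y` arises from `x` by giving a vertex the opinion opposite to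
that of one of its neighbours. -/
def AntiVoterStep (x y : V → Bool) : Prop :=
  ∃ i j, G.Adj i j ∧ y = Function.update x i (!x j)

/-- Starting from `x`, update the vertices along a walk one after the other, each from its
predecessor on the walk. -/
def followWalk : ∀ {u v : V}, G.Walk u v → (V → Bool) → V → Bool
  | _, _, .nil, x => x
  | u, _, .cons (v := w) _ p, x => followWalk p (Function.update x w (!x u))

theorem reflTransGen_followWalk {u v : V} (p : G.Walk u v) (x : V → Bool) :
    Relation.ReflTransGen (AntiVoterStep G) x (followWalk p x) := by
  induction p generalizing x with
  | nil => exact .refl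
  | @cons u w v h p ih => exact .head ⟨w, u, h.symm, rfl⟩ (ih _)

theorem followWalk_of_notMem {u v : V} (p : G.Walk u v) (x : V → Bool) {a : V}
    (ha : a ∉ p.support) : followWalk p x a = x a := by
  induction p generalizing x with
  | nil => rfl
  | @cons u w v h p ih =>
    rw [Walk.support_cons, List.mem_cons, not_or] at ha
    have haw : a ≠ w := fun e ↦ ha.2 (e ▸ p.start_mem_support)
    rw [followWalk, ih _ ha.2, Function.update_of_ne haw]

theorem followWalk_congr {u v : V} (p : G.Walk u v) {x y : V → Bool} (hxy : x u = y u) {a : V}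
    (ha : a ∈ p.support) : followWalk p x a = followWalk p y a := by
  induction p generalizing x y with
  | nil =>
    rw [Walk.support_nil, List.mem_singleton] at ha
    subst ha
    exact hxy
  | @cons u w v h p ih =>
    rw [followWalk, followWalk]
    by_cases hap : a ∈ p.support
    · exact ih (by simp only [Function.update_self, hxy]) hap
    · obtain rfl := (List.mem_cons.1 (Walk.support_cons h p ▸ ha)).resolve_right hap
      rw [followWalk_of_notMem p _ hap, followWalk_of_notMem p _ hap,
        Function.update_of_ne h.ne, Function.update_of_ne h.ne, hxy]

theorem followWalk_end {u v : V} (p : G.Walk u v) (x : V → Bool) :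
    followWalk p x v = if Even p.length then x u else !x u := by
  induction p generalizing x with
  | nil => simp [followWalk]
  | @cons u w v h p ih =>
    rw [followWalk, ih, Walk.length_cons]
    by_cases he : Even p.length <;> simp [he, Nat.even_add_one]

theorem exists_reflTransGen_agree_at {x y : V → Bool} {v : V} (hv : OnOddClosedWalk G v)
    (hxy : x v ≠ y v) :
    ∃ x' y', Relation.ReflTransGen (AntiVoterStep G) x x' ∧
      Relation.ReflTransGen (AntiVoterStep G) y y' ∧ x' v = y' v ∧
      ∀ a, x a = y a → x' a = y' a := by
  obtain ⟨p, hp⟩ := hv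
  -- One round along `p` reverses the opinion of `v`. The states `followWalk p x` and `y` agree at
  -- `v`, so a further round along `p` makes them agree on all of `p`.
  have hend : followWalk p x v = y v := by
    rw [followWalk_end, if_neg (Nat.not_even_iff_odd.2 hp)]
    exact Bool.not_eq_eq_eq_not.2 (Bool.eq_not_of_ne hxy)
  refine ⟨followWalk p (followWalk p x), followWalk p y,
    (reflTransGen_followWalk p x).trans (reflTransGen_followWalk p _),
    reflTransGen_followWalk p y, followWalk_congr p hend p.start_mem_support, fun a ha ↦ ?_⟩
  by_cases hs : a ∈ p.support
  · exact followWalk_congr p hend hs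
  · simp only [followWalk_of_notMem p _ hs, ha]

theorem join_reflTransGen_antiVoterStep [Finite V] (x y : V → Bool)
    (hxy : ∀ v, ¬ OnOddClosedWalk G v → x v = y v) :
    Relation.Join (Relation.ReflTransGen (AntiVoterStep G)) x y := by
  cases nonempty_fintype V
  induction hn : ({v | x v ≠ y v} : Finset V) using Finset.strongInduction generalizing x y with
  | _ s ih =>
    by_cases h : x = y
    · exact ⟨x, .refl, h ▸ .refl⟩
    obtain ⟨v, hv⟩ := Function.ne_iff.1 h
    obtain ⟨x', y', hx, hy, hv', hagree⟩ :=
      exists_reflTransGen_agree_at (not_not.1 (mt (hxy v) hv)) hv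
    have hlt : ({a | x' a ≠ y' a} : Finset V) ⊂ s := by
      refine (Finset.ssubset_iff_of_subset fun a ha ↦ ?_).2 ⟨v, ?_, ?_⟩
      · simpa [← hn] using mt (hagree a) (by simpa using ha)
      · simpa [← hn] using hv
      · simpa using hv'
    obtain ⟨z, hxz, hyz⟩ := ih _ hlt x' y' (fun a ha ↦ hagree a (hxy a ha)) rfl
    exact ⟨z, hx.trans hxz, hy.trans hyz⟩

end AntiVoterStep

section Spin

/-- The opinions `1` and `0` as the spins `1` and `-1`. -/
def spin (b : Bool) : ℝ := 2 * (b.toNat : ℝ) - 1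

@[simp] theorem spin_not (b : Bool) : spin (!b) = -spin b := by
  cases b <;> norm_num [spin]

theorem spin_ne_zero (b : Bool) : spin b ≠ 0 := by
  cases b <;> norm_num [spin]

variable {V : Type*} [Fintype V]

/-- The sum of all spins, an affine function of the number of opinions `1`. -/
def totalSpin (x : V → Bool) : ℝ := ∑ i, spin (x i)

theorem oneCount_eq_totalSpin (x : V → Bool) :
    (oneCount x : ℝ) = (Fintype.card V + totalSpin x) / 2 := by
  simp only [oneCount, totalSpin, spin, Finset.sum_sub_distrib, ← Finset.mul_sum]
  push_cast
  simp

theorem sum_mul_comp_update [DecidableEq V] {α R : Type*} [CommRing R] (d : V → R) (f : α → R)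
    (x : V → α) (i : V) (a : α) :
    ∑ v, d v * f (Function.update x i a v) = ∑ v, d v * f (x v) + d i * (f a - f (x i)) := by
  rw [← Finset.add_sum_erase _ _ (Finset.mem_univ i),
    ← Finset.add_sum_erase _ (fun v ↦ d v * f (x v)) (Finset.mem_univ i),
    Finset.sum_congr rfl fun j hj ↦ by rw [Function.update_of_ne (Finset.ne_of_mem_erase hj)],
    Function.update_self]
  ring

theorem totalSpin_update [DecidableEq V] (x : V → Bool) (i : V) (b : Bool) :
    totalSpin (Function.update x i b) = totalSpin x + (spin b - spin (x i)) := by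
  simpa only [totalSpin, one_mul] using sum_mul_comp_update (fun _ ↦ 1) spin x i b

theorem oneCount_update [DecidableEq V] (x : V → Bool) (i : V) (b : Bool) :
    oneCount (Function.update x i b) = oneCount x + (b.toNat - (x i).toNat : ℤ) := by
  simpa only [oneCount, one_mul] using
    sum_mul_comp_update (fun _ ↦ (1 : ℤ)) (fun b ↦ (b.toNat : ℤ)) x i b

end Spin

section NeighbourSums

variable {V : Type*} [Fintype V] {G : SimpleGraph V} [DecidableRel G.Adj] {r : ℕ}

variable (G) in
theorem sum_neighborFinset_comm (F : V → V → ℝ) :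
    ∑ i, ∑ j ∈ G.neighborFinset i, F i j = ∑ i, ∑ j ∈ G.neighborFinset i, F j i :=
  Finset.sum_comm' fun i j ↦ by simp [G.adj_comm]

theorem sum_neighborFinset_left (hreg : G.IsRegularOfDegree r) (f : V → ℝ) :
    ∑ i, ∑ _j ∈ G.neighborFinset i, f i = r * ∑ i, f i := by
  simp only [Finset.sum_const, card_neighborFinset_eq_degree, hreg.degree_eq, nsmul_eq_mul,
    Finset.mul_sum]

theorem sum_neighborFinset_right (hreg : G.IsRegularOfDegree r) (f : V → ℝ) :
    ∑ i, ∑ j ∈ G.neighborFinset i, f j = r * ∑ i, f i := by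
  rw [sum_neighborFinset_comm G fun _ j ↦ f j, sum_neighborFinset_left hreg]

theorem sum_eq_zero_of_alternating (hreg : G.IsRegularOfDegree r) (hr : r ≠ 0) {o : V → ℝ}
    (ho : ∀ i j, G.Adj i j → o i = -o j) : ∑ i, o i = 0 := by
  have h : (r : ℝ) * ∑ i, o i = -(r * ∑ i, o i) :=
    calc (r : ℝ) * ∑ i, o i = ∑ i, ∑ _j ∈ G.neighborFinset i, o i :=
          (sum_neighborFinset_left hreg o).symm
      _ = ∑ i, ∑ j ∈ G.neighborFinset i, -o j := Finset.sum_congr rfl fun i _ ↦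
          Finset.sum_congr rfl fun j hj ↦ ho i j ((G.mem_neighborFinset i j).1 hj)
      _ = -(r * ∑ i, o i) := by
          rw [sum_neighborFinset_right hreg fun j ↦ -o j, Finset.sum_neg_distrib, mul_neg]
  exact (mul_eq_zero.1 (self_eq_neg.1 h)).resolve_left (by exact_mod_cast hr)

theorem neighbourProductSum_eq (x : V → Bool) :
    neighbourProductSum G x = ∑ i, ∑ j ∈ G.neighborFinset i, spin (x i) * spin (x j) := rfl

theorem neighbourProductSum_flipOdd (x : V → Bool) :
    neighbourProductSum G (flipOdd G x) = neighbourProductSum G x := by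
  simp only [neighbourProductSum_eq]
  refine Finset.sum_congr rfl fun i _ ↦ Finset.sum_congr rfl fun j hj ↦ ?_
  have h := onOddClosedWalk_iff_of_adj ((G.mem_neighborFinset i j).1 hj)
  by_cases hi : OnOddClosedWalk G i
  · simp [flipOdd, hi, h.1 hi]
  · simp [flipOdd, hi, mt h.2 hi]

end NeighbourSums

section TransitionMatrix

variable {V : Type*} [Fintype V] [DecidableEq V] {G : SimpleGraph V} [DecidableRel G.Adj] {r : ℕ}

variable (G) in
/-- The transition matrix of the anti-voter chain; it acts on functions of the state by `*ᵥ` and on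
laws of the state by `ᵥ*`. -/
def antiVoterMatrix : Matrix (V → Bool) (V → Bool) ℝ := .of (antiVoterTransition G)

variable (G) in
/-- The probability that one step of the chain from `x` increases the number of opinions `1`. -/
def upRate (x : V → Bool) : ℝ :=
  (antiVoterMatrix G *ᵥ fun y ↦ if oneCount y = oneCount x + 1 then 1 else 0) x

theorem antiVoterMatrix_mulVec (hreg : G.IsRegularOfDegree r) (f : (V → Bool) → ℝ)
    (x : V → Bool) : (antiVoterMatrix G *ᵥ f) x = 1 / (Fintype.card V * r : ℝ) *
      ∑ i, ∑ j ∈ G.neighborFinset i, f (Function.update x i (!x j)) := by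
  have hone : ∀ i j, ∑ y, (if Function.update x i (!x j) = y then 1 else 0) * f y =
      f (Function.update x i (!x j)) := fun i j ↦ by simp
  simp only [Matrix.mulVec, dotProduct, antiVoterMatrix, Matrix.of_apply, antiVoterTransition,
    hreg.degree_eq, ← hone, Finset.mul_sum, Finset.sum_mul]
  rw [Finset.sum_comm]
  refine Finset.sum_congr rfl fun i _ ↦ ?_
  rw [Finset.sum_comm]
  refine Finset.sum_congr rfl fun j _ ↦ Finset.sum_congr rfl fun y _ ↦ ?_
  rw [← one_div_mul_one_div]
  ring

theorem antiVoterTransition_nonneg (x y : V → Bool) : 0 ≤ antiVoterTransition G x y := by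
  unfold antiVoterTransition
  positivity

theorem antiVoterTransition_pos_iff {x y : V → Bool} :
    0 < antiVoterTransition G x y ↔ AntiVoterStep G x y := by
  constructor
  · intro h
    obtain ⟨i, -, hi⟩ := Finset.exists_ne_zero_of_sum_ne_zero (right_ne_zero_of_mul h.ne')
    obtain ⟨j, hj, hij⟩ := Finset.exists_ne_zero_of_sum_ne_zero (right_ne_zero_of_mul hi)
    exact ⟨i, j, (G.mem_neighborFinset i j).1 hj, (by simpa using hij : _ = y).symm⟩
  · rintro ⟨i, j, hij, rfl⟩
    have : Nonempty V := ⟨i⟩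
    have hdeg : 0 < G.degree i := (G.degree_pos_iff_exists_adj i).2 ⟨j, hij⟩
    refine mul_pos (by positivity) (Finset.sum_pos' (fun _ _ ↦ by positivity)
      ⟨i, Finset.mem_univ i, mul_pos (by positivity) (Finset.sum_pos' (fun _ _ ↦ by positivity)
        ⟨j, (G.mem_neighborFinset i j).2 hij, by simp⟩)⟩)

theorem antiVoterTransition_flipOdd (x y : V → Bool) :
    antiVoterTransition G (flipOdd G x) (flipOdd G y) = antiVoterTransition G x y := by
  unfold antiVoterTransition
  congr! 4 with i _ j hj
  simp only [← flipOdd_update ((G.mem_neighborFinset i j).1 hj),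
    flipOdd_involutive.injective.eq_iff]

theorem join_reflTransGen_flipOdd (x : V → Bool) :
    Relation.Join (Relation.ReflTransGen fun x y ↦ 0 < antiVoterMatrix G x y) x
      (flipOdd G x) := by
  simpa only [antiVoterMatrix, Matrix.of_apply, antiVoterTransition_pos_iff] using
    join_reflTransGen_antiVoterStep x (flipOdd G x) fun v hv ↦ by simp [flipOdd, hv]

variable [Nonempty V]

theorem antiVoterMatrix_mem_rowStochastic (hreg : G.IsRegularOfDegree r) (hr : r ≠ 0) :
    antiVoterMatrix G ∈ Matrix.rowStochastic ℝ (V → Bool) := by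
  refine Matrix.mem_rowStochastic.2 ⟨antiVoterTransition_nonneg, funext fun x ↦ ?_⟩
  rw [antiVoterMatrix_mulVec hreg]
  simp only [Pi.one_apply]
  rw [sum_neighborFinset_left hreg fun _ ↦ 1, Finset.sum_const, Finset.card_univ, nsmul_one]
  field_simp

theorem antiVoterMatrix_mulVec_totalSpin (hreg : G.IsRegularOfDegree r) (hr : r ≠ 0) :
    antiVoterMatrix G *ᵥ totalSpin = (1 - 2 / (Fintype.card V : ℝ)) • totalSpin := by
  ext x
  rw [antiVoterMatrix_mulVec hreg]
  simp only [totalSpin_update, spin_not, Finset.sum_add_distrib, Finset.sum_sub_distrib,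
    Finset.sum_neg_distrib, Pi.smul_apply, smul_eq_mul]
  rw [sum_neighborFinset_left hreg fun _ ↦ totalSpin x,
    sum_neighborFinset_left hreg fun i ↦ spin (x i),
    sum_neighborFinset_right hreg fun i ↦ spin (x i), Finset.sum_const, Finset.card_univ,
    nsmul_eq_mul, ← totalSpin]
  field_simp
  ring

theorem upRate_eq (hreg : G.IsRegularOfDegree r) (hr : r ≠ 0) (x : V → Bool) :
    upRate G x = 3 / 4 + (neighbourProductSum G x / (4 * Fintype.card V * r) -
      oneCount x / Fintype.card V) := by
  have hup : ∀ i j, (if oneCount (Function.update x i (!x j)) = oneCount x + 1 then (1 : ℝ)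
      else 0) = 1 / 4 * (1 - spin (x i) - spin (x j) + spin (x i) * spin (x j)) := fun i j ↦ by
    rw [oneCount_update]
    cases x i <;> cases x j <;> norm_num [spin]
  rw [upRate, antiVoterMatrix_mulVec hreg]
  simp_rw [hup, ← Finset.mul_sum, Finset.sum_add_distrib, Finset.sum_sub_distrib]
  rw [← neighbourProductSum_eq, sum_neighborFinset_left hreg fun _ ↦ 1,
    sum_neighborFinset_left hreg fun i ↦ spin (x i),
    sum_neighborFinset_right hreg fun i ↦ spin (x i), Finset.sum_const, Finset.card_univ,
    nsmul_eq_mul, ← totalSpin, oneCount_eq_totalSpin]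
  field_simp
  ring

theorem antiVoterMatrix_mulVec_sq_of_alternating (hreg : G.IsRegularOfDegree r) (hr : r ≠ 0)
    {d : V → ℝ} (hd : ∀ i j, G.Adj i j → d i = -d j) :
    (antiVoterMatrix G *ᵥ fun x ↦ (∑ v, d v * spin (x v)) ^ 2) =
      (fun x ↦ (∑ v, d v * spin (x v)) ^ 2) + fun x ↦ 1 / (Fintype.card V * r : ℝ) *
        ∑ i, ∑ j ∈ G.neighborFinset i, (d i * (spin (x i) + spin (x j))) ^ 2 := by
  ext x
  set T := ∑ v, d v * spin (x v) with hT
  have hupdate : ∀ i, ∀ j ∈ G.neighborFinset i,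
      (∑ v, d v * spin (Function.update x i (!x j) v)) ^ 2 =
        T ^ 2 + 2 * T * (d j * spin (x j)) - 2 * T * (d i * spin (x i)) +
          (d i * (spin (x i) + spin (x j))) ^ 2 := fun i j hj ↦ by
    rw [sum_mul_comp_update, spin_not, ← hT, hd i j ((G.mem_neighborFinset i j).1 hj)]
    ring
  rw [antiVoterMatrix_mulVec hreg, Finset.sum_congr rfl fun i _ ↦ Finset.sum_congr rfl (hupdate i)]
  simp only [Finset.sum_add_distrib, Finset.sum_sub_distrib, Pi.add_apply, ← hT]
  rw [sum_neighborFinset_left hreg fun _ ↦ T ^ 2,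
    sum_neighborFinset_right hreg fun j ↦ 2 * T * (d j * spin (x j)),
    sum_neighborFinset_left hreg fun i ↦ 2 * T * (d i * spin (x i)),
    Finset.sum_const, Finset.card_univ, nsmul_eq_mul]
  field_simp
  ring

end TransitionMatrix

section StationaryLaw

variable {V : Type*} [Fintype V] [DecidableEq V] {G : SimpleGraph V}
  [DecidableRel G.Adj] {r : ℕ} {π : (V → Bool) → ℝ}

theorem vecMul_antiVoterMatrix_comp_flipOdd (hπ : π ᵥ* antiVoterMatrix G = π) :
    (π ∘ flipOdd G) ᵥ* antiVoterMatrix G = π ∘ flipOdd G := by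
  ext y
  conv_rhs => rw [Function.comp_apply, ← hπ]
  simp only [Matrix.vecMul, dotProduct, Function.comp_apply]
  rw [← Equiv.sum_comp (flipOdd_involutive (G := G)).toPerm]
  simp only [Function.Involutive.coe_toPerm, flipOdd_involutive _, antiVoterMatrix,
    Matrix.of_apply, ← antiVoterTransition_flipOdd (flipOdd G _) y]

variable [Nonempty V]

theorem stationary_flipOdd (hreg : G.IsRegularOfDegree r) (hr : r ≠ 0)
    (hπ : π ᵥ* antiVoterMatrix G = π) (x : V → Bool) : π (flipOdd G x) = π x := by
  have hle : ∀ x, π x ≤ π (flipOdd G x) := fun x ↦ by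
    by_contra! hx
    have h := nonneg_of_join_of_pos (ν := π - π ∘ flipOdd G)
      (antiVoterMatrix_mem_rowStochastic hreg hr)
      (by rw [Matrix.sub_vecMul, hπ, vecMul_antiVoterMatrix_comp_flipOdd hπ])
      (by simpa using hx) (join_reflTransGen_flipOdd x)
    simp only [Pi.sub_apply, Function.comp_apply, flipOdd_involutive x] at h
    linarith
  refine le_antisymm ?_ (hle x)
  simpa only [flipOdd_involutive x] using hle (flipOdd G x)

theorem stationary_dotProduct_totalSpin (hreg : G.IsRegularOfDegree r) (hr : r ≠ 0)
    (hπ : π ᵥ* antiVoterMatrix G = π) : π ⬝ᵥ totalSpin = 0 := by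
  have h := Matrix.dotProduct_mulVec π (antiVoterMatrix G) totalSpin
  rw [hπ, antiVoterMatrix_mulVec_totalSpin hreg hr, dotProduct_smul, smul_eq_mul] at h
  have hzero : 2 / (Fintype.card V : ℝ) * (π ⬝ᵥ totalSpin) = 0 := by linarith
  exact (mul_eq_zero.1 hzero).resolve_left (by positivity)

theorem spin_alternating_off_onOddClosedWalk (hreg : G.IsRegularOfDegree r) (hr : r ≠ 0)
    (hπ0 : 0 ≤ π) (hπ : π ᵥ* antiVoterMatrix G = π) {x : V → Bool} (hx : 0 < π x) {i j : V}
    (hij : G.Adj i j) (hi : ¬ OnOddClosedWalk G i) : spin (x i) = -spin (x j) := by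
  obtain ⟨d, hd0, hd⟩ := exists_alternating_eq_zero_iff_onOddClosedWalk G
  have hzero := eq_zero_of_mulVec_eq_add hπ0 hπ
    (antiVoterMatrix_mulVec_sq_of_alternating hreg hr hd) (fun x ↦ by positivity) hx
  have hsum := (mul_eq_zero.1 hzero).resolve_left (by positivity)
  rw [Finset.sum_eq_zero_iff_of_nonneg fun _ _ ↦ by positivity] at hsum
  have hsum' := hsum i (Finset.mem_univ i)
  rw [Finset.sum_eq_zero_iff_of_nonneg fun _ _ ↦ by positivity] at hsum'
  have hterm := pow_eq_zero_iff two_ne_zero |>.1 (hsum' j ((G.mem_neighborFinset i j).2 hij))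
  exact eq_neg_of_add_eq_zero_left ((mul_eq_zero.1 hterm).resolve_left (mt (hd0 i).1 hi))

open Classical in
theorem totalSpin_flipOdd (hreg : G.IsRegularOfDegree r) (hr : r ≠ 0) (hπ0 : 0 ≤ π)
    (hπ : π ᵥ* antiVoterMatrix G = π) {x : V → Bool} (hx : 0 < π x) :
    totalSpin (flipOdd G x) = -totalSpin x := by
  have hoff : ∑ i, (if OnOddClosedWalk G i then 0 else spin (x i)) = 0 :=
    sum_eq_zero_of_alternating hreg hr fun i j hij ↦ by
      by_cases hi : OnOddClosedWalk G i
      · simp [hi, (onOddClosedWalk_iff_of_adj hij).1 hi]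
      · rw [if_neg hi, if_neg (mt (onOddClosedWalk_iff_of_adj hij).2 hi)]
        exact spin_alternating_off_onOddClosedWalk hreg hr hπ0 hπ hx hij hi
  have hadd : totalSpin (flipOdd G x) + totalSpin x =
      2 * ∑ i, (if OnOddClosedWalk G i then 0 else spin (x i)) := by
    rw [totalSpin, totalSpin, ← Finset.sum_add_distrib, Finset.mul_sum]
    refine Finset.sum_congr rfl fun i _ ↦ ?_
    by_cases hi : OnOddClosedWalk G i <;> simp [flipOdd, hi, two_mul]
  linarith

theorem stationary_dotProduct_totalSpin_mul_neighbourProductSum (hreg : G.IsRegularOfDegree r)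
    (hr : r ≠ 0) (hπ0 : 0 ≤ π) (hπ : π ᵥ* antiVoterMatrix G = π) :
    π ⬝ᵥ (totalSpin * neighbourProductSum G) = 0 := by
  have hflip : ∀ x, π (flipOdd G x) * (totalSpin (flipOdd G x) *
      neighbourProductSum G (flipOdd G x)) = -(π x * (totalSpin x * neighbourProductSum G x)) :=
    fun x ↦ by
      rw [stationary_flipOdd hreg hr hπ, neighbourProductSum_flipOdd]
      rcases (hπ0 x).eq_or_lt with hx | hx
      · simp [← hx]
      · rw [totalSpin_flipOdd hreg hr hπ0 hπ hx]
        ring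
  have h := Equiv.sum_comp (flipOdd_involutive (G := G)).toPerm
    fun x ↦ π x * (totalSpin x * neighbourProductSum G x)
  simp only [Function.Involutive.coe_toPerm, hflip, Finset.sum_neg_distrib] at h
  exact self_eq_neg.1 h.symm

theorem exists_pos_totalSpin_ne_zero (hreg : G.IsRegularOfDegree r) (hr : r ≠ 0)
    (hbip : ¬ G.IsBipartite) (hπ1 : π ⬝ᵥ 1 = 1) (hπ : π ᵥ* antiVoterMatrix G = π) :
    ∃ x, 0 < π x ∧ totalSpin x ≠ 0 := by
  by_contra! hzero
  obtain ⟨x, -, hx⟩ : ∃ x ∈ Finset.univ, 0 < π x :=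
    Finset.exists_lt_of_sum_lt (f := 0) (by
      rw [← dotProduct_one π, hπ1]
      simp)
  -- No step from `x` changes the total spin, so the opinions of neighbours differ.
  refine hbip (Coloring.colorable (α := Bool) ⟨x, fun {i j} hij e ↦ ?_⟩ |>.mono (by simp))
  have hij : G.Adj i j := hij
  have hstep := hzero _ (pos_of_vecMul_eq_of_pos (antiVoterMatrix_mem_rowStochastic hreg hr) hπ hx
    (antiVoterTransition_pos_iff.2 ⟨i, j, hij, rfl⟩))
  rw [totalSpin_update, hzero x hx, spin_not, e] at hstep
  exact spin_ne_zero (x j) (by linarith)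

theorem stationary_dotProduct_totalSpin_sq_pos (hreg : G.IsRegularOfDegree r) (hr : r ≠ 0)
    (hbip : ¬ G.IsBipartite) (hπ0 : 0 ≤ π) (hπ1 : π ⬝ᵥ 1 = 1)
    (hπ : π ᵥ* antiVoterMatrix G = π) : 0 < π ⬝ᵥ totalSpin ^ 2 := by
  obtain ⟨x, hx, hspin⟩ := exists_pos_totalSpin_ne_zero hreg hr hbip hπ1 hπ
  exact Finset.sum_pos' (fun x _ ↦ mul_nonneg (hπ0 x) (sq_nonneg _))
    ⟨x, Finset.mem_univ x, mul_pos hx (sq_pos_of_ne_zero hspin)⟩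

end StationaryLaw

section FiniteStateSpace

variable {Ω α : Type*} [MeasurableSpace Ω] {P : Measure Ω} [MeasurableSpace α] {X : Ω → α}

/-- The law of `X` as a vector of point probabilities, on which transition matrices act. -/
def lawVector (P : Measure Ω) (X : Ω → α) : α → ℝ := fun x ↦ (P.map X).real {x}

theorem lawVector_nonneg : 0 ≤ lawVector P X := fun _ ↦ measureReal_nonneg

theorem ae_of_lawVector_pos [Countable α] [IsFiniteMeasure P] (hX : Measurable X) {p : α → Prop}
    (h : ∀ x, 0 < lawVector P X x → p x) : ∀ᵐ ω ∂P, p (X ω) := by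
  refine ae_of_ae_map hX.aemeasurable (ae_iff_of_countable.2 fun x hx ↦ h x ?_)
  exact ENNReal.toReal_pos hx (measure_ne_top _ _)

variable [DiscreteMeasurableSpace α]

theorem memLp_comp_of_finite [Finite α] [IsFiniteMeasure P] (hX : Measurable X) (f : α → ℝ)
    (p : ℝ≥0∞) : MemLp (fun ω ↦ f (X ω)) p P :=
  MemLp.of_discrete.comp_of_map hX.aemeasurable

theorem integrable_comp_of_finite [Finite α] [IsFiniteMeasure P] (hX : Measurable X)
    (f : α → ℝ) : Integrable (fun ω ↦ f (X ω)) P :=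
  memLp_one_iff_integrable.1 (memLp_comp_of_finite hX f 1)

variable [Fintype α]

theorem integral_comp_eq_lawVector_dotProduct [IsFiniteMeasure P] (hX : Measurable X)
    (f : α → ℝ) : ∫ ω, f (X ω) ∂P = lawVector P X ⬝ᵥ f := by
  rw [← integral_map hX.aemeasurable Measurable.of_discrete.aestronglyMeasurable,
    integral_fintype .of_finite]
  rfl

theorem lawVector_dotProduct_one [IsProbabilityMeasure P] (hX : Measurable X) :
    lawVector P X ⬝ᵥ 1 = 1 := by
  simp [← integral_comp_eq_lawVector_dotProduct hX]

end FiniteStateSpace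

section CondExp

variable {Ω : Type*} {m m₀ : MeasurableSpace Ω} {P : Measure Ω} [IsProbabilityMeasure P]
  {X : Ω → ℝ}

theorem variance_condExp_le (hm : m ≤ m₀) (hX : MemLp X 2 P) : Var[P[X | m]; P] ≤ Var[X; P] := by
  have hvar := integral_condVar_add_variance_condExp hm hX
  have hnonneg : 0 ≤ ∫ ω, Var[X; P | m] ω ∂P :=
    integral_nonneg_of_ae (condExp_nonneg (ae_of_all _ fun _ ↦ sq_nonneg _))
  linarith

end CondExp

section Regular

variable {V : Type*} [Fintype V] {G : SimpleGraph V}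

theorem ne_zero_of_isRegularOfDegree_of_not_isBipartite [DecidableRel G.Adj] {r : ℕ}
    (hreg : G.IsRegularOfDegree r) (hbip : ¬ G.IsBipartite) : r ≠ 0 := by
  rintro rfl
  refine hbip (Coloring.colorable (α := Fin 2) ⟨fun _ ↦ 0, fun {i j} hij ↦ ?_⟩)
  exact ((G.degree_eq_zero i).1 (hreg i) j hij).elim

theorem two_lt_card_of_not_isBipartite (hbip : ¬ G.IsBipartite) : 2 < Fintype.card V := by
  by_contra! h
  exact hbip (G.colorable_of_fintype.mono h)

end Regular

namespace IsEquilibriumAntiVoter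

variable {V : Type*} [Fintype V] [DecidableEq V] {G : SimpleGraph V} [DecidableRel G.Adj]
  {Ω : Type*} [MeasurableSpace Ω] {P : Measure Ω} {J : ℕ → Ω → V → Bool} {r : ℕ}

theorem measurable_pair (hJ : IsEquilibriumAntiVoter G P J) :
    Measurable fun ω ↦ (J 0 ω, J 1 ω) :=
  (hJ.measurable 0).prodMk (hJ.measurable 1)

theorem measurable_oneCount (hJ : IsEquilibriumAntiVoter G P J) (t : ℕ) :
    Measurable fun ω ↦ oneCount (J t ω) :=
  (Measurable.of_discrete (f := oneCount)).comp (hJ.measurable t)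

theorem comap_oneCount_le (hJ : IsEquilibriumAntiVoter G P J) :
    MeasurableSpace.comap (fun ω ↦ oneCount (J 0 ω)) ⊤ ≤ ‹MeasurableSpace Ω› :=
  (hJ.measurable_oneCount 0).comap_le

theorem map_oneCount (hJ : IsEquilibriumAntiVoter G P J) (t : ℕ) :
    P.map (fun ω ↦ oneCount (J t ω)) = P.map fun ω ↦ oneCount (J 0 ω) := by
  have h : ∀ s, P.map (fun ω ↦ oneCount (J s ω)) = (P.map (J s)).map oneCount := fun s ↦
    (Measure.map_map (g := oneCount) Measurable.of_discrete (hJ.measurable s)).symm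
  rw [h, h, hJ.stationary t]

theorem lawVector_pair (hJ : IsEquilibriumAntiVoter G P J) (x y : V → Bool) :
    lawVector P (fun ω ↦ (J 0 ω, J 1 ω)) (x, y) =
      lawVector P (J 0) x * antiVoterMatrix G x y := by
  have h := hJ.markov 0 fun s ↦ if s = 0 then x else y
  rw [lawVector, lawVector, map_measureReal_apply hJ.measurable_pair (measurableSet_singleton _),
    map_measureReal_apply (hJ.measurable 0) (measurableSet_singleton x)]
  convert h using 2
  · ext ω
    simp [Nat.le_one_iff_eq_zero_or_eq_one]
  · congr 1
    ext ω
    simp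
  · simp [antiVoterMatrix]

variable [IsProbabilityMeasure P]

theorem integral_comp_pair (hJ : IsEquilibriumAntiVoter G P J)
    (F : (V → Bool) → (V → Bool) → ℝ) :
    ∫ ω, F (J 0 ω) (J 1 ω) ∂P =
      lawVector P (J 0) ⬝ᵥ fun x ↦ (antiVoterMatrix G *ᵥ F x) x := by
  rw [integral_comp_eq_lawVector_dotProduct hJ.measurable_pair fun z ↦ F z.1 z.2]
  simp only [dotProduct, Matrix.mulVec, Fintype.sum_prod_type, hJ.lawVector_pair, Finset.mul_sum,
    mul_assoc]

theorem lawVector_vecMul (hJ : IsEquilibriumAntiVoter G P J) :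
    lawVector P (J 0) ᵥ* antiVoterMatrix G = lawVector P (J 0) := by
  refine dotProduct_eq _ _ fun f ↦ ?_
  have h1 : lawVector P (J 1) = lawVector P (J 0) := by
    unfold lawVector
    rw [hJ.stationary 1]
  rw [← Matrix.dotProduct_mulVec, ← hJ.integral_comp_pair fun _ ↦ f,
    integral_comp_eq_lawVector_dotProduct (hJ.measurable 1), h1]

theorem ae_oneCount_step (hJ : IsEquilibriumAntiVoter G P J) :
    ∀ᵐ ω ∂P, oneCount (J 1 ω) - oneCount (J 0 ω) = -1 ∨ oneCount (J 1 ω) - oneCount (J 0 ω) = 0 ∨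
      oneCount (J 1 ω) - oneCount (J 0 ω) = 1 := by
  refine ae_of_lawVector_pos hJ.measurable_pair (p := fun z ↦ oneCount z.2 - oneCount z.1 = -1 ∨
    oneCount z.2 - oneCount z.1 = 0 ∨ oneCount z.2 - oneCount z.1 = 1) fun z hz ↦ ?_
  rw [hJ.lawVector_pair] at hz
  obtain ⟨i, j, -, h⟩ := antiVoterTransition_pos_iff.1 (pos_of_mul_pos_right hz measureReal_nonneg)
  rw [h, oneCount_update]
  cases z.1 i <;> cases z.1 j <;> simp

theorem condExp_comp_pair (hJ : IsEquilibriumAntiVoter G P J) (w : (V → Bool) → ℤ)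
    (F : (V → Bool) → (V → Bool) → ℝ) :
    P[fun ω ↦ F (J 0 ω) (J 1 ω) | MeasurableSpace.comap (fun ω ↦ w (J 0 ω)) ⊤] =ᵐ[P]
      P[fun ω ↦ (antiVoterMatrix G *ᵥ F (J 0 ω)) (J 0 ω) |
        MeasurableSpace.comap (fun ω ↦ w (J 0 ω)) ⊤] := by
  have hw : Measurable fun ω ↦ w (J 0 ω) := Measurable.of_discrete.comp (hJ.measurable 0)
  have hint := integrable_comp_of_finite (P := P) (hJ.measurable 0)
    fun x ↦ (antiVoterMatrix G *ᵥ F x) x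
  refine (ae_eq_condExp_of_forall_setIntegral_eq hw.comap_le
    (integrable_comp_of_finite hJ.measurable_pair fun z ↦ F z.1 z.2)
    (fun _ _ _ ↦ integrable_condExp.integrableOn) (fun s hs _ ↦ ?_)
    stronglyMeasurable_condExp.aestronglyMeasurable).symm
  rw [setIntegral_condExp hw.comap_le hint hs]
  obtain ⟨A, -, rfl⟩ := hs
  rw [← integral_indicator (hw .of_discrete), ← integral_indicator (hw .of_discrete)]
  classical
  have h₀ := integral_comp_eq_lawVector_dotProduct (P := P) (hJ.measurable 0) fun x ↦
    if w x ∈ A then (antiVoterMatrix G *ᵥ F x) x else 0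
  have h₁ := hJ.integral_comp_pair fun x y ↦ if w x ∈ A then F x y else 0
  calc _ = lawVector P (J 0) ⬝ᵥ fun x ↦ if w x ∈ A then (antiVoterMatrix G *ᵥ F x) x else 0 := by
        exact h₀
    _ = lawVector P (J 0) ⬝ᵥ fun x ↦
          (antiVoterMatrix G *ᵥ fun y ↦ if w x ∈ A then F x y else 0) x := by
        congr! 2 with x
        split_ifs with hx
        · rfl
        · simp [Matrix.mulVec, dotProduct]
    _ = _ := h₁.symm

variable [Nonempty V]

theorem integral_oneCount (hJ : IsEquilibriumAntiVoter G P J) (hreg : G.IsRegularOfDegree r)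
    (hr : r ≠ 0) : ∫ ω, (oneCount (J 0 ω) : ℝ) ∂P = Fintype.card V / 2 := by
  simp only [oneCount_eq_totalSpin]
  rw [integral_div, integral_add (integrable_const _)
      (integrable_comp_of_finite (hJ.measurable 0) totalSpin),
    integral_comp_eq_lawVector_dotProduct (hJ.measurable 0),
    stationary_dotProduct_totalSpin hreg hr hJ.lawVector_vecMul]
  simp

theorem oneCount_sub_integral (hJ : IsEquilibriumAntiVoter G P J) (hreg : G.IsRegularOfDegree r)
    (hr : r ≠ 0) (x : V → Bool) :
    (oneCount x : ℝ) - ∫ ω, (oneCount (J 0 ω) : ℝ) ∂P = totalSpin x / 2 := by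
  rw [hJ.integral_oneCount hreg hr, oneCount_eq_totalSpin]
  ring

theorem variance_oneCount_pos (hJ : IsEquilibriumAntiVoter G P J) (hreg : G.IsRegularOfDegree r)
    (hr : r ≠ 0) (hbip : ¬ G.IsBipartite) : 0 < Var[fun ω ↦ (oneCount (J 0 ω) : ℝ); P] := by
  rw [variance_eq_integral (integrable_comp_of_finite (hJ.measurable 0)
    fun x ↦ (oneCount x : ℝ)).1.aemeasurable]
  simp only [hJ.oneCount_sub_integral hreg hr, div_pow]
  rw [integral_div, integral_comp_eq_lawVector_dotProduct (hJ.measurable 0) (totalSpin · ^ 2)]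
  exact div_pos (stationary_dotProduct_totalSpin_sq_pos hreg hr hbip lawVector_nonneg
    (lawVector_dotProduct_one (hJ.measurable 0)) hJ.lawVector_vecMul) (by norm_num)

theorem condExp_oneCount (hJ : IsEquilibriumAntiVoter G P J) (hreg : G.IsRegularOfDegree r)
    (hr : r ≠ 0) :
    P[fun ω ↦ (oneCount (J 1 ω) : ℝ) - ∫ ω, (oneCount (J 0 ω) : ℝ) ∂P |
      MeasurableSpace.comap (fun ω ↦ oneCount (J 0 ω)) ⊤] =ᵐ[P]
    fun ω ↦ (1 - 2 / (Fintype.card V : ℝ)) *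
      ((oneCount (J 0 ω) : ℝ) - ∫ ω, (oneCount (J 0 ω) : ℝ) ∂P) := by
  set μ := ∫ ω, (oneCount (J 0 ω) : ℝ) ∂P
  set g : ℤ → ℝ := fun w ↦ (1 - 2 / (Fintype.card V : ℝ)) * (w - μ)
  have hdrift : ∀ x, (antiVoterMatrix G *ᵥ fun y ↦ (oneCount y : ℝ) - μ) x = g (oneCount x) :=
    fun x ↦ by
      have hspin : (fun y : V → Bool ↦ (oneCount y : ℝ) - μ) = (1 / 2 : ℝ) • totalSpin := by
        ext y
        rw [hJ.oneCount_sub_integral hreg hr y, Pi.smul_apply, smul_eq_mul]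
        ring
      rw [hspin, Matrix.mulVec_smul, antiVoterMatrix_mulVec_totalSpin hreg hr, smul_comm, ← hspin]
      rfl
  have h := hJ.condExp_comp_pair oneCount fun _ y ↦ (oneCount y : ℝ) - μ
  simp only [hdrift] at h
  have hmeas : StronglyMeasurable[MeasurableSpace.comap (fun ω ↦ oneCount (J 0 ω)) ⊤]
      fun ω ↦ g (oneCount (J 0 ω)) :=
    ((Measurable.of_discrete (f := g)).comp (comap_measurable _)).stronglyMeasurable
  rwa [condExp_of_stronglyMeasurable hJ.comap_oneCount_le hmeas
    (integrable_comp_of_finite (hJ.measurable 0) fun x ↦ g (oneCount x))] at h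

theorem covariance_oneCount_neighbourProductSum (hJ : IsEquilibriumAntiVoter G P J)
    (hreg : G.IsRegularOfDegree r) (hr : r ≠ 0) :
    cov[fun ω ↦ (oneCount (J 0 ω) : ℝ), fun ω ↦ neighbourProductSum G (J 0 ω); P] = 0 := by
  have hspin : cov[fun ω ↦ totalSpin (J 0 ω), fun ω ↦ neighbourProductSum G (J 0 ω); P] = 0 := by
    rw [covariance_eq_sub (memLp_comp_of_finite (hJ.measurable 0) totalSpin 2)
        (memLp_comp_of_finite (hJ.measurable 0) (neighbourProductSum G) 2),
      integral_comp_eq_lawVector_dotProduct (hJ.measurable 0) totalSpin,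
      stationary_dotProduct_totalSpin hreg hr hJ.lawVector_vecMul, zero_mul, sub_zero]
    exact (integral_comp_eq_lawVector_dotProduct (hJ.measurable 0)
      (totalSpin * neighbourProductSum G)).trans
      (stationary_dotProduct_totalSpin_mul_neighbourProductSum hreg hr lawVector_nonneg
        hJ.lawVector_vecMul)
  simp only [oneCount_eq_totalSpin]
  rw [covariance_fun_div_left, covariance_const_add_left
    (integrable_comp_of_finite (hJ.measurable 0) totalSpin), hspin, zero_div]

theorem variance_upRate (hJ : IsEquilibriumAntiVoter G P J) (hreg : G.IsRegularOfDegree r)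
    (hr : r ≠ 0) :
    Var[fun ω ↦ upRate G (J 0 ω); P] =
    (16 * (r : ℝ) ^ 2 * Var[fun ω ↦ (oneCount (J 0 ω) : ℝ); P] +
      Var[fun ω ↦ neighbourProductSum G (J 0 ω); P]) /
      (16 * (r : ℝ) ^ 2 * (Fintype.card V : ℝ) ^ 2) := by
  have hLp := memLp_comp_of_finite (P := P) (hJ.measurable 0) (p := 2)
  have hQ := hLp fun x ↦ neighbourProductSum G x / (4 * Fintype.card V * r)
  have hW := hLp fun x ↦ (oneCount x : ℝ) / Fintype.card V
  simp only [upRate_eq hreg hr]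
  have hconst := variance_const_add (hQ.sub hW).1 (3 / 4)
  simp only [Pi.sub_apply] at hconst
  rw [hconst, variance_sub hQ hW, covariance_fun_div_left, covariance_fun_div_right,
    covariance_comm, hJ.covariance_oneCount_neighbourProductSum hreg hr]
  simp only [div_eq_mul_inv, variance_mul_const]
  field_simp
  ring

theorem variance_condExp_up_le (hJ : IsEquilibriumAntiVoter G P J) (hreg : G.IsRegularOfDegree r)
    (hr : r ≠ 0) :
    Var[P[{ω | oneCount (J 1 ω) = oneCount (J 0 ω) + 1}.indicator (fun _ ↦ (1 : ℝ)) |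
      MeasurableSpace.comap (fun ω ↦ oneCount (J 0 ω)) ⊤]; P] ≤
    (16 * (r : ℝ) ^ 2 * Var[fun ω ↦ (oneCount (J 0 ω) : ℝ); P] +
      Var[fun ω ↦ neighbourProductSum G (J 0 ω); P]) /
      (16 * (r : ℝ) ^ 2 * (Fintype.card V : ℝ) ^ 2) := by
  have hind : {ω | oneCount (J 1 ω) = oneCount (J 0 ω) + 1}.indicator (fun _ ↦ (1 : ℝ)) =
      fun ω ↦ if oneCount (J 1 ω) = oneCount (J 0 ω) + 1 then 1 else 0 := by
    ext ω
    simp [Set.indicator]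
  rw [hind, variance_congr (hJ.condExp_comp_pair oneCount fun x y ↦
    if oneCount y = oneCount x + 1 then 1 else 0), ← hJ.variance_upRate hreg hr]
  exact variance_condExp_le hJ.comap_oneCount_le
    (memLp_comp_of_finite (hJ.measurable 0) (upRate G) 2)

end IsEquilibriumAntiVoter

section Rates

variable {d s a n p q r : ℝ}

theorem add_rpow_three_halves_le (hs : 0 ≤ s) (ha : 0 ≤ a) :
    (s + a) ^ (3 / 2 : ℝ) ≤ 2 * (s ^ (3 / 2 : ℝ) + a ^ (3 / 2 : ℝ)) := by
  lift s to ℝ≥0 using hs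
  lift a to ℝ≥0 using ha
  have hp := NNReal.coe_le_coe.2
    (NNReal.rpow_add_le_mul_rpow_add_rpow s a (p := 3 / 2) (by norm_num))
  push_cast at hp
  refine hp.trans ?_
  gcongr
  calc (2 : ℝ) ^ (3 / 2 - 1 : ℝ) ≤ 2 ^ (1 : ℝ) := by gcongr <;> norm_num
    _ = 2 := Real.rpow_one 2

theorem rpow_three_halves_mul_self (hs : 0 ≤ s) :
    s ^ (3 / 2 : ℝ) * s ^ (3 / 2 : ℝ) = s ^ 3 := by
  rw [← Real.rpow_add_of_nonneg hs (by norm_num) (by norm_num), ← Real.rpow_natCast]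
  norm_num

theorem rpow_three_halves_eq_mul_sqrt (hs : 0 ≤ s) : s ^ (3 / 2 : ℝ) = s * √s := by
  rw [show (3 / 2 : ℝ) = 1 + 1 / 2 by norm_num, Real.rpow_add_of_nonneg hs (by norm_num)
    (by norm_num), Real.rpow_one, Real.sqrt_eq_rpow]

theorem le_mul_div_sq_add_inv_of_le_one (hs : 0 < s) (ha : 0 ≤ a) (hd1 : d ≤ 1)
    (hd : d ≤ (s + a) / (2 * s ^ 2) + 2 / s ^ 2) : d ≤ 4 * (a / s ^ 2 + 1 / s) := by
  have has : 0 ≤ a / s ^ 2 := by positivity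
  have hinv : 0 < 1 / s := by positivity
  rcases le_total 1 s with h | h
  · have hsq : 1 / s ^ 2 ≤ 1 / s := by
      gcongr
      exact le_self_pow₀ h two_ne_zero
    calc d ≤ 1 / s / 2 + a / s ^ 2 / 2 + 2 * (1 / s ^ 2) := hd.trans_eq (by field_simp)
      _ ≤ _ := by linarith
  · have hone : 1 ≤ 1 / s := (one_le_div hs).2 h
    linarith

theorem le_mul_rpow_add_of_le_one (hs : 0 < s) (ha : 0 ≤ a) (hd1 : d ≤ 1)
    (hd : d ≤ (s + a) ^ (3 / 2 : ℝ) / s ^ 3 + 2 / s ^ 2) :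
    d ≤ 4 * (a ^ (3 / 2 : ℝ) / s ^ 3 + 1 / s ^ (3 / 2 : ℝ)) := by
  have has : 0 ≤ a ^ (3 / 2 : ℝ) / s ^ 3 := by positivity
  rcases le_total 1 s with h | h
  · have hsq : 2 / s ^ 2 ≤ 2 * (1 / s ^ (3 / 2 : ℝ)) := by
      rw [mul_one_div, ← Real.rpow_natCast]
      gcongr
      norm_num
    have hcube : s ^ (3 / 2 : ℝ) / s ^ 3 = 1 / s ^ (3 / 2 : ℝ) := by
      rw [← rpow_three_halves_mul_self hs.le]
      field_simp
    calc d ≤ 2 * (s ^ (3 / 2 : ℝ) + a ^ (3 / 2 : ℝ)) / s ^ 3 + 2 * (1 / s ^ (3 / 2 : ℝ)) := by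
          refine hd.trans (add_le_add ?_ hsq)
          gcongr
          exact add_rpow_three_halves_le hs.le ha
      _ = 2 * (a ^ (3 / 2 : ℝ) / s ^ 3) + 4 * (1 / s ^ (3 / 2 : ℝ)) := by
          rw [← hcube]
          ring
      _ ≤ _ := by linarith
  · have hone : 1 ≤ 1 / s ^ (3 / 2 : ℝ) :=
      (one_le_div (by positivity)).2 (Real.rpow_le_one hs.le h (by norm_num))
    linarith

theorem sqrt_le_of_le_div (hr : 0 < r) (hn : 0 < n) (hs : 0 ≤ s) (hq : 0 ≤ q)
    (h : p ≤ (16 * r ^ 2 * s ^ 2 + q) / (16 * r ^ 2 * n ^ 2)) :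
    √p ≤ 2 / n * (s + √q / r) / 2 := by
  refine Real.sqrt_le_iff.2 ⟨by positivity, ?_⟩
  calc p ≤ (16 * r ^ 2 * s ^ 2 + √q ^ 2) / (16 * r ^ 2 * n ^ 2) := by rwa [Real.sq_sqrt hq]
    _ = (s ^ 2 + 1 / 16 * (√q / r) ^ 2) / n ^ 2 := by field_simp
    _ ≤ (s + √q / r) ^ 2 / n ^ 2 := by
        gcongr
        nlinarith [mul_nonneg hs (show 0 ≤ √q / r by positivity), sq_nonneg (√q / r)]
    _ = _ := by field_simp

theorem sqrt_div_rpow_three_halves (hq : 0 ≤ q) (hr : 0 ≤ r) :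
    (√q / r) ^ (3 / 2 : ℝ) = q ^ (3 / 4 : ℝ) / r ^ (3 / 2 : ℝ) := by
  rw [Real.div_rpow (Real.sqrt_nonneg q) hr, Real.sqrt_eq_rpow, ← Real.rpow_mul hq]
  norm_num

end Rates

section Distances

variable (P Q : Measure ℤ) [IsProbabilityMeasure P] [IsProbabilityMeasure Q]

theorem abs_measureReal_sub_measureReal_le_one (A : Set ℤ) : |P.real A - Q.real A| ≤ 1 :=
  abs_sub_le_of_nonneg_of_le measureReal_nonneg measureReal_le_one measureReal_nonneg
    measureReal_le_one

theorem tvDistInt_le_one : tvDistInt P Q ≤ 1 :=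
  ciSup_le (abs_measureReal_sub_measureReal_le_one P Q)

theorem locDistInt_le_one : locDistInt P Q ≤ 1 :=
  ciSup_le fun k ↦ abs_measureReal_sub_measureReal_le_one P Q {k}

end Distances

namespace HasSteinIdentity

variable {Ω : Type*} [MeasurableSpace Ω] {P : Measure Ω} [IsProbabilityMeasure P] {W : Ω → ℤ}
  {S : Ω → ℝ} {lam μ s a : ℝ}

theorem tvDistInt_translatedPoisson_le_of_sqrt_variance_le (h : HasSteinIdentity P W S lam)
    (hμ : ∫ ω, (W ω : ℝ) ∂P = μ) (hvar : Var[fun ω ↦ (W ω : ℝ); P] = s ^ 2) (hs : 0 < s)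
    (ha : 0 ≤ a) (hS : √(Var[S; P]) ≤ lam * (s + a) / 2) :
    tvDistInt (P.map W) (translatedPoisson μ (s ^ 2)) ≤ 4 * (a / s ^ 2 + 1 / s) := by
  have := Measure.isProbabilityMeasure_map h.measurable.aemeasurable (μ := P)
  have hlam := h.pos
  refine le_mul_div_sq_add_inv_of_le_one hs ha (tvDistInt_le_one _ _) ?_
  calc _ ≤ √(Var[S; P]) / (lam * s ^ 2) + 2 / s ^ 2 :=
        h.tvDistInt_translatedPoisson_le hμ hvar (by positivity)
    _ ≤ lam * (s + a) / 2 / (lam * s ^ 2) + 2 / s ^ 2 := by gcongr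
    _ = _ := by field_simp

theorem maxPointProb_map_le (h : HasSteinIdentity P W S lam)
    (hvar : Var[fun ω ↦ (W ω : ℝ); P] = s ^ 2) (hs : 0 < s) (ha : 0 ≤ a)
    (hS : √(Var[S; P]) ≤ lam * (s + a) / 2) : maxPointProb (P.map W) ≤ (s + a) / s ^ 2 := by
  have hlam := h.pos
  refine ciSup_le fun k ↦ ?_
  calc _ ≤ (1 / s + √(Var[S; P]) / (lam * s ^ 2)) / 2 := by
        simpa only [hvar, Real.sqrt_sq hs.le] using
          h.measureReal_map_singleton_le (by rw [hvar]; positivity) k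
    _ ≤ (1 / s + lam * (s + a) / 2 / (lam * s ^ 2)) / 2 := by gcongr
    _ = (3 * s + a) / (4 * s ^ 2) := by
        field_simp
        ring
    _ ≤ (4 * (s + a)) / (4 * s ^ 2) := by
        gcongr
        linarith
    _ = _ := by field_simp

theorem locDistInt_translatedPoisson_le_of_sqrt_variance_le (h : HasSteinIdentity P W S lam)
    (hμ : ∫ ω, (W ω : ℝ) ∂P = μ) (hvar : Var[fun ω ↦ (W ω : ℝ); P] = s ^ 2) (hs : 0 < s)
    (ha : 0 ≤ a) (hS : √(Var[S; P]) ≤ lam * (s + a) / 2) :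
    locDistInt (P.map W) (translatedPoisson μ (s ^ 2)) ≤
      4 * (a ^ (3 / 2 : ℝ) / s ^ 3 + 1 / s ^ (3 / 2 : ℝ)) := by
  have := Measure.isProbabilityMeasure_map h.measurable.aemeasurable (μ := P)
  have hlam := h.pos
  have hsqrt : √(maxPointProb (P.map W) * Var[S; P]) ≤ √(s + a) / s * (lam * (s + a) / 2) := by
    rw [Real.sqrt_mul (maxPointProb_nonneg _)]
    gcongr
    rw [← Real.sqrt_sq hs.le, ← Real.sqrt_div' _ (sq_nonneg s), Real.sqrt_sq hs.le]
    exact Real.sqrt_le_sqrt (h.maxPointProb_map_le hvar hs ha hS)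
  refine le_mul_rpow_add_of_le_one hs ha (locDistInt_le_one _ _) ?_
  calc _ ≤ 2 * √(maxPointProb (P.map W) * Var[S; P]) / (lam * s ^ 2) + 2 / s ^ 2 :=
        h.locDistInt_translatedPoisson_le hμ hvar (by positivity)
    _ ≤ 2 * (√(s + a) / s * (lam * (s + a) / 2)) / (lam * s ^ 2) + 2 / s ^ 2 := by gcongr
    _ = _ := by
        rw [rpow_three_halves_eq_mul_sqrt (by positivity)]
        field_simp

end HasSteinIdentity

namespace IsEquilibriumAntiVoter

variable {V : Type*} [Fintype V] [DecidableEq V] {G : SimpleGraph V} [DecidableRel G.Adj] {r : ℕ}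
  {Ω : Type*} [MeasurableSpace Ω] {P : Measure Ω} [IsProbabilityMeasure P] {J : ℕ → Ω → V → Bool}

theorem ae_abs_oneCount_sub_le_one (hJ : IsEquilibriumAntiVoter G P J) :
    ∀ᵐ ω ∂P, |oneCount (J 1 ω) - oneCount (J 0 ω)| ≤ 1 :=
  hJ.ae_oneCount_step.mono fun ω h ↦ abs_le.2 (by lia)

theorem map_oneCount_prodMk_comm (hJ : IsEquilibriumAntiVoter G P J) :
    P.map (fun ω ↦ (oneCount (J 0 ω), oneCount (J 1 ω))) =
      P.map (fun ω ↦ (oneCount (J 1 ω), oneCount (J 0 ω))) :=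
  map_prodMk_comm_of_abs_sub_le_one (hJ.measurable_oneCount 0) (hJ.measurable_oneCount 1)
    (hJ.map_oneCount 1) hJ.ae_abs_oneCount_sub_le_one

theorem hasSteinIdentity [Nonempty V] (hJ : IsEquilibriumAntiVoter G P J)
    (hreg : G.IsRegularOfDegree r) (hr : r ≠ 0) :
    HasSteinIdentity P (fun ω ↦ oneCount (J 0 ω))
      P[{ω | oneCount (J 1 ω) = oneCount (J 0 ω) + 1}.indicator (fun _ ↦ (1 : ℝ)) |
        MeasurableSpace.comap (fun ω ↦ oneCount (J 0 ω)) ⊤] (2 / (Fintype.card V : ℝ)) :=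
  hasSteinIdentity_of_exchangeable (hJ.measurable_oneCount 0) (hJ.measurable_oneCount 1)
    (memLp_comp_of_finite (hJ.measurable 0) (fun x ↦ (oneCount x : ℝ)) 2)
    hJ.map_oneCount_prodMk_comm hJ.ae_abs_oneCount_sub_le_one (by positivity)
    (hJ.condExp_oneCount hreg hr)

end IsEquilibriumAntiVoter

theorem theorem4p5_general {V : Type*} [Fintype V] [DecidableEq V] {G : SimpleGraph V}
    [DecidableRel G.Adj] {r : ℕ} {Ω : Type*} [MeasurableSpace Ω] {P : Measure Ω}
    [IsProbabilityMeasure P] {J : ℕ → Ω → V → Bool} (hreg : G.IsRegularOfDegree r)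
    (hbip : ¬ G.IsBipartite) (hJ : IsEquilibriumAntiVoter G P J) :
    let n : ℝ := Fintype.card V
    let W : Ω → ℤ := fun ω ↦ oneCount (J 0 ω)
    let W' : Ω → ℤ := fun ω ↦ oneCount (J 1 ω)
    let Q : Ω → ℝ := fun ω ↦ neighbourProductSum G (J 0 ω)
    let μ : ℝ := ∫ ω, (W ω : ℝ) ∂P
    let σ : ℝ := √(Var[fun ω ↦ (W ω : ℝ); P])
    let lam : ℝ := 2 / n
    let S : Ω → ℝ := P[{ω | W' ω = W ω + 1}.indicator (fun _ ↦ (1 : ℝ)) | .comap W ⊤]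
    0 < σ ∧ 0 < lam ∧ lam < 1 ∧
    P.map (fun ω ↦ (W ω, W' ω)) = P.map (fun ω ↦ (W' ω, W ω)) ∧
    P[fun ω ↦ (W' ω : ℝ) - μ | .comap W ⊤] =ᵐ[P] (fun ω ↦ (1 - lam) * ((W ω : ℝ) - μ)) ∧
    (∀ᵐ ω ∂P, W' ω - W ω = -1 ∨ W' ω - W ω = 0 ∨ W' ω - W ω = 1) ∧
    tvDistInt (P.map W) (translatedPoisson μ (σ ^ 2)) ≤
      √(Var[S; P]) / (lam * σ ^ 2) + 2 / σ ^ 2 ∧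
    locDistInt (P.map W) (translatedPoisson μ (σ ^ 2)) ≤
      2 * √(maxPointProb (P.map W) * Var[S; P]) / (lam * σ ^ 2) + 2 / σ ^ 2 ∧
    Var[S; P] ≤ (16 * (r : ℝ) ^ 2 * σ ^ 2 + Var[Q; P]) / (16 * (r : ℝ) ^ 2 * n ^ 2) ∧
    tvDistInt (P.map W) (translatedPoisson μ (σ ^ 2)) ≤
      4 * (√(Var[Q; P]) / (r * σ ^ 2) + 1 / σ) ∧
    locDistInt (P.map W) (translatedPoisson μ (σ ^ 2)) ≤
      4 * (Var[Q; P] ^ (3 / 4 : ℝ) / ((r : ℝ) ^ (3 / 2 : ℝ) * σ ^ 3) + 1 / σ ^ (3 / 2 : ℝ)) := by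
  intro n W W' Q μ σ lam S
  have hr := ne_zero_of_isRegularOfDegree_of_not_isBipartite hreg hbip
  have hr0 : (0 : ℝ) < r := by positivity
  have hcard := two_lt_card_of_not_isBipartite hbip
  have : Nonempty V := Fintype.card_pos_iff.1 (two_pos.trans hcard)
  have hn : 2 < n := Nat.ofNat_lt_cast.2 hcard
  have hn0 : 0 < n := two_pos.trans hn
  have hvar := hJ.variance_oneCount_pos hreg hr hbip
  have hσ : 0 < σ := Real.sqrt_pos.2 hvar
  have hσ2 : Var[fun ω ↦ (W ω : ℝ); P] = σ ^ 2 := (Real.sq_sqrt hvar.le).symm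
  have hlam : 0 < lam := by positivity
  have hstein : HasSteinIdentity P W S lam := hJ.hasSteinIdentity hreg hr
  have hS := hσ2 ▸ hJ.variance_condExp_up_le hreg hr
  have hsqrt := sqrt_le_of_le_div hr0 hn0 hσ.le (variance_nonneg Q P) hS
  have ha : 0 ≤ √(Var[Q; P]) / r := by positivity
  refine ⟨hσ, hlam, (div_lt_one hn0).2 hn, hJ.map_oneCount_prodMk_comm,
    hJ.condExp_oneCount hreg hr, hJ.ae_oneCount_step,
    hstein.tvDistInt_translatedPoisson_le rfl hσ2 (by positivity),
    hstein.locDistInt_translatedPoisson_le rfl hσ2 (by positivity), hS, ?_, ?_⟩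
  · rw [← div_div]
    exact hstein.tvDistInt_translatedPoisson_le_of_sqrt_variance_le rfl hσ2 hσ ha hsqrt
  · rw [← div_div, ← sqrt_div_rpow_three_halves (variance_nonneg Q P) hr0.le]
    exact hstein.locDistInt_translatedPoisson_le_of_sqrt_variance_le rfl hσ2 hσ ha hsqrt

end

theorem theorem4p5 :
    ∃ C : ℝ, ∀ (V : Type*) [Fintype V] [DecidableEq V] (G : SimpleGraph V) [DecidableRel G.Adj]
      (n r : ℕ) (Ω : Type*) [MeasurableSpace Ω] (P : Measure Ω) [IsProbabilityMeasure P]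
      (J : ℕ → Ω → V → Bool),
      Fintype.card V = n →
      G.IsRegularOfDegree r →
      ¬ G.IsBipartite →
      ¬ Nonempty (G ≃g SimpleGraph.cycleGraph n) →
      IsEquilibriumAntiVoter G P J →
      let W : Ω → ℤ := fun ω => oneCount (J 0 ω)
      let W' : Ω → ℤ := fun ω => oneCount (J 1 ω)
      let Q : Ω → ℝ := fun ω => neighbourProductSum G (J 0 ω)
      let μ : ℝ := ∫ ω, (W ω : ℝ) ∂P
      let varW : ℝ := variance (fun ω => (W ω : ℝ)) P
      let σ : ℝ := Real.sqrt varW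
      let lam : ℝ := 2 / (n : ℝ)
      -- the conditional probability of `W' = W + 1` given `W`
      let S : Ω → ℝ :=
        P[Set.indicator {ω | W' ω = W ω + 1} (fun _ => (1 : ℝ)) | MeasurableSpace.comap W ⊤]
      let varS : ℝ := variance S P
      let varQ : ℝ := variance Q P
      let qmax : ℝ := maxPointProb (P.map W)
      -- the set-up, with `R = 0` and `λ = 2 / n`
      0 < σ ∧ 0 < lam ∧ lam < 1 ∧
      P.map (fun ω => (W ω, W' ω)) = P.map (fun ω => (W' ω, W ω)) ∧
      (P[fun ω => (W' ω : ℝ) - μ | MeasurableSpace.comap W ⊤] =ᵐ[P] fun ω => (1 - lam) * ((W ω : ℝ) - μ)) ∧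
      (∀ᵐ ω ∂P, W' ω - W ω = -1 ∨ W' ω - W ω = 0 ∨ W' ω - W ω = 1) ∧
      -- the two general bounds, with `R = 0` and `λ = 2 / n`
      tvDistInt (P.map W) (translatedPoisson μ (σ ^ 2)) ≤
        Real.sqrt varS / (lam * σ ^ 2) + 2 / σ ^ 2 ∧
      locDistInt (P.map W) (translatedPoisson μ (σ ^ 2)) ≤
        2 * Real.sqrt (qmax * varS) / (lam * σ ^ 2) + 2 / σ ^ 2 ∧
      -- the variance bound
      varS ≤ (16 * (r : ℝ) ^ 2 * σ ^ 2 + varQ) / (16 * (r : ℝ) ^ 2 * (n : ℝ) ^ 2) ∧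
      -- the rates, with an absolute constant
      tvDistInt (P.map W) (translatedPoisson μ (σ ^ 2)) ≤
        C * (Real.sqrt varQ / ((r : ℝ) * σ ^ 2) + 1 / σ) ∧
      locDistInt (P.map W) (translatedPoisson μ (σ ^ 2)) ≤
        C * (varQ ^ (3 / 4 : ℝ) / ((r : ℝ) ^ (3 / 2 : ℝ) * σ ^ 3) + 1 / σ ^ (3 / 2 : ℝ)) := by
  refine ⟨4, fun V _ _ G _ n r Ω _ P _ J hcard hreg hbip _ hJ ↦ ?_⟩
  subst hcard
  exact theorem4p5_general hreg hbip hJ
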